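/- A graph $\mathcal G=(V,E)$ here is a directed graph that contains all self-loops $i\to i$; it is a DAG if it has no directed cycle apart from the self-loops. For every $n\ge 0$ fix a diagonal positive definite matrix $C_n\in\mathbb R^{n\times n}$ (for instance $C_n=2I_n$). For a graph $\mathcal G=(V,E)$ with $V=\{1,\dots,n\}$ let $$\mathcal M_{\mathcal G}=\{\Sigma\in\mathrm{PD}_n : M\Sigma+\Sigma M^T+C_n=0 \text{ for some stable } M\in\mathbb R^{n\times n} \text{ with } m_{ji}=0 \text{ whenever } i\to j\notin E\},$$ where $\mathrm{PD}_n$ is the set of symmetric positive definite real $n\times n$ matrices and $M$ is stable if all its complex eigenvalues have negative real part. Two graphs $\mathcal G_1,\mathcal G_2$ on the same vertex set are model equivalent if $\mathcal M_{\mathcal G_1}=\mathcal M_{\mathcal G_2}$. A DAG $\mathcal G$ on $V$ is structurally identifiable within the class of Lyapunov DAG models if $\mathcal G$ is the only DAG on $V$ that is model equivalent to $\mathcal G$. Graphs are given to a Turing machine by their adjacency matrices. Then: 1. There is a Turing machine that decides, for every input DAG $\mathcal G$ (with any number $n$ of vertices), in time polynomial in the length of the input, whether $\mathcal G$ is structurally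 identifiable within the class of Lyapunov DAG models. 2. There is a Turing machine that decides, for every pair of input DAGs $\mathcal G_1,\mathcal G_2$ on the same vertex set, in time polynomial in the length of the input, whether $\mathcal G_1$ and $\mathcal G_2$ are model equivalent. -/

import Mathlib

open scoped Matrix

/-- A directed graph on the vertex set `V` that contains every self-loop `i → i`. -/
@[ext]
structure LoopedDigraph (V : Type) extends Digraph V where
  loop : ∀ i, Adj i i

namespace LoopedDigraph

/-- `G` is acyclic (a DAG) if the graph without its self-loops has no directed cycle. -/
def IsAcyclic {V : Type} (G : LoopedDigraph V) : Prop :=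
  ∀ i, ¬ Relation.TransGen (fun a b => a ≠ b ∧ G.Adj a b) i i

end LoopedDigraph

/-- A real square matrix is stable if all its complex eigenvalues have negative real part. -/
def IsStableMatrix {V : Type} [Fintype V] [DecidableEq V] (M : Matrix V V ℝ) : Prop :=
  ∀ z ∈ spectrum ℂ (M.map (fun x : ℝ => (x : ℂ))), z.re < 0

/-- `M ∈ ℝ^E`: the entry `M j i` vanishes unless `i → j` is an edge of `G`. -/
def IsSparseMatrix {V : Type} (G : LoopedDigraph V) (M : Matrix V V ℝ) : Prop :=
  ∀ i j, ¬ G.Adj i j → M j i = 0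

/-- The graphical continuous Lyapunov model of `G` with volatility matrix `C`, as the set of
covariance matrices of its (centred normal) distributions. -/
def lyapunovModel {V : Type} [Fintype V] [DecidableEq V] (G : LoopedDigraph V)
    (C : Matrix V V ℝ) : Set (Matrix V V ℝ) :=
  {S | S.PosDef ∧ ∃ M : Matrix V V ℝ,
    IsStableMatrix M ∧ IsSparseMatrix G M ∧ M * S + S * Mᵀ + C = 0}

/-- Model equivalence in the Lyapunov sense. -/
def ModelEquivalent {V : Type} [Fintype V] [DecidableEq V] (C : Matrix V V ℝ)
    (G H : LoopedDigraph V) : Prop :=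
  lyapunovModel G C = lyapunovModel H C

/-- `G ∈ L` is structurally identifiable within the class `L` of graphs over `V` if its model
equivalence class meets `L` in exactly one element. -/
def StructurallyIdentifiableWithin {V : Type} [Fintype V] [DecidableEq V] (C : Matrix V V ℝ)
    (L : Set (LoopedDigraph V)) (G : LoopedDigraph V) : Prop :=
  G ∈ L ∧ ∃! H : LoopedDigraph V, H ∈ L ∧ ModelEquivalent C G H

/-- The DAGs on the vertex set `{0, …, n - 1}`. -/
abbrev DAG (n : ℕ) : Type := {G : LoopedDigraph (Fin n) // G.IsAcyclic}

open scoped Classical in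
/-- The adjacency matrix of a graph as a list of rows; entry `j` of row `i` is the bit
`some b` with `b = true` iff `i → j` is an edge, and `none` marks the end of the row. -/
noncomputable def adjRows {n : ℕ} (G : LoopedDigraph (Fin n)) : List (List (Option Bool)) :=
  List.ofFn fun i : Fin n => (List.ofFn fun j : Fin n => some (decide (G.Adj i j))) ++ [none]

/-- The adjacency matrix of a graph as a word of length `n * (n + 1)` over a three-letter
alphabet, row by row. -/
noncomputable def encodeGraph {n : ℕ} (G : LoopedDigraph (Fin n)) : List (Option Bool) :=
  (adjRows G).flatten

/-- Encoding of the instances "a DAG". -/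
noncomputable def encodeDAG (x : Σ n : ℕ, DAG n) : List (Option Bool) :=
  encodeGraph x.2.1

/-- Encoding of the instances "two DAGs on the same vertex set": the word of the first graph
followed by the word of the second one, the latter written in a disjoint copy of the alphabet. -/
noncomputable def encodeDAGPair (x : Σ n : ℕ, DAG n × DAG n) :
    List (Option Bool ⊕ Option Bool) :=
  (encodeGraph x.2.1.1).map Sum.inl ++ (encodeGraph x.2.2.1).map Sum.inr

theorem length_encodeGraph {n : ℕ} (G : LoopedDigraph (Fin n)) :
    (encodeGraph G).length = n * (n + 1) := by
  simp [encodeGraph, adjRows, List.length_flatten, List.map_ofFn, Function.comp_def]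

theorem encodeGraph_injective {n : ℕ} :
    Function.Injective (encodeGraph : LoopedDigraph (Fin n) → List (Option Bool)) := by
  intro G H h
  have h1 : adjRows G = adjRows H := by
    rw [List.eq_iff_flatten_eq]
    exact ⟨h, by simp [adjRows, List.map_ofFn, Function.comp_def]⟩
  have h2 := List.ofFn_injective h1
  ext i j
  have h3 := congrFun h2 i
  have h4 := List.ofFn_injective (List.append_cancel_right h3)
  have h5 := congrFun h4 j
  simpa using h5

theorem encodeDAG_injective : Function.Injective encodeDAG := by
  rintro ⟨n, G⟩ ⟨m, H⟩ h
  have hl : n * (n + 1) = m * (m + 1) := by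
    rw [← length_encodeGraph G.1, ← length_encodeGraph H.1]
    exact congrArg List.length h
  obtain rfl : n = m := by
    rcases lt_trichotomy n m with h' | h' | h'
    · nlinarith
    · exact h'
    · nlinarith
  have : G = H := Subtype.ext (encodeGraph_injective h)
  rw [this]

theorem encodeDAGPair_injective : Function.Injective encodeDAGPair := by
  rintro ⟨n, G, G'⟩ ⟨m, H, H'⟩ h
  have h1 : encodeGraph G.1 = encodeGraph H.1 := by
    have := congrArg (List.filterMap Sum.getLeft?) h
    simpa [encodeDAGPair, List.filterMap_append, List.filterMap_map, Function.comp_def] using this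
  have h2 : encodeGraph G'.1 = encodeGraph H'.1 := by
    have := congrArg (List.filterMap Sum.getRight?) h
    simpa [encodeDAGPair, List.filterMap_append, List.filterMap_map, Function.comp_def] using this
  have h3 : (⟨n, G⟩ : Σ n, DAG n) = ⟨m, H⟩ := encodeDAG_injective h1
  have h4 : (⟨n, G'⟩ : Σ n, DAG n) = ⟨m, H'⟩ := encodeDAG_injective h2
  cases h3
  cases h4
  rfl

/-- The decision problem `P`, with instances `a : α` given as the words `enc a`, is decidable in
polynomial time: one multi-stack Turing machine, with finite alphabets, computes the truth value
of `P a` from `enc a` within a number of steps polynomial in the length of `enc a`. -/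
def DecidableInPolyTime {α Γ : Type} (enc : α → List Γ) (P : α → Prop) : Prop :=
  ∃ f : α → Bool, (∀ a, f a = true ↔ P a) ∧
    ∃ T : Turing.TM2ComputableInPolyTime enc Computability.encodeBool f,
      ∀ k, Finite (T.tm.Γ k)

/-! ### The Lyapunov equation and regression vectors. -/

section Lyapunov

/-! Both problems reduce to conditions on graphs that involve at most four vertices at a time. Two
DAGs have the same model iff they have the same skeleton and, for every edge i → j that is reversed
in the other graph, i and j have the same neighbours and both satisfy `Local`, a restriction on
unshielded paths of length two (`modelEquivalent_iff`). A DAG is identifiable iff it has no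
`Reversible` edge (`structurallyIdentifiableWithin_iff`). Nested loops over the vertices decide both
conditions.

Since C is positive definite, stability of M follows from the equation, so for fixed S membership in
the model means that a linear system in the sparse matrix M is solvable.

Sufficiency: M may be changed by any K with KS skew-symmetric. For a reversible edge i → j, a K of
rank at most two, built from regression vectors, cancels the entry of M for i → j and otherwise
touches only entries that the reversed graph permits. This uses that disjoint ancestral sets are
uncorrelated (`cov_eq_zero_of_isAncestral`). The reversal amounts to exchanging the names i and j,
so it keeps the graph acyclic. Among the edges on which two locally equivalent DAGs disagree, one is
always reversible (`exists_reversible`), and reversing it reduces the disagreement.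

Necessity: inclusion of models passes to induced subgraphs, with C normalised to the identity
(`exists_sparse_of_lyapunovModel_subset`). Each violation of the criterion appears on at most four
vertices, where an explicit covariance matrix for G turns the equation for H into an inconsistent
linear system.

Complexity: a small language of stack programs is compiled to Turing machines with exact step
counts. The properties that it evaluates in polynomial time (`Comp`) contain the edge relations and
are closed under connectives and under quantification over vertices, with four variables available.
-/

theorem Matrix.PosDef.transpose_eq {V : Type} {S : Matrix V V ℝ} (hS : S.PosDef) : Sᵀ = S := by
  simpa [Matrix.conjTranspose_eq_transpose_of_trivial] using hS.isHermitian.eq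

variable {V : Type} [Fintype V]

theorem Matrix.PosDef.dotProduct_mulVec_pos_real {S : Matrix V V ℝ} (hS : S.PosDef) {x : V → ℝ}
    (hx : x ≠ 0) : 0 < x ⬝ᵥ S *ᵥ x := by
  simpa using hS.dotProduct_mulVec_pos hx

/-- Evaluate the equation as a quadratic form at x: as S is symmetric, its first two terms are
transposes of each other and contribute equally. -/
theorem two_mul_lyapunov_quadratic {M S C : Matrix V V ℝ} (hS : Sᵀ = S)
    (h : M * S + S * Mᵀ + C = 0) (x : V → ℝ) :
    2 * ((x ᵥ* M) ⬝ᵥ (S *ᵥ x)) = -(x ⬝ᵥ C *ᵥ x) := by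
  have h1 : x ⬝ᵥ (M * S + S * Mᵀ + C) *ᵥ x = 0 := by simp [h]
  have h2 : x ⬝ᵥ (S * Mᵀ) *ᵥ x = x ⬝ᵥ (M * S) *ᵥ x := by
    have : (S * Mᵀ) = (M * S)ᵀ := by rw [Matrix.transpose_mul, hS]
    rw [this, Matrix.mulVec_transpose, dotProduct_comm, ← Matrix.dotProduct_mulVec]
  have h3 : (x ᵥ* M) ⬝ᵥ (S *ᵥ x) = x ⬝ᵥ (M * S) *ᵥ x := by
    rw [← Matrix.dotProduct_mulVec, Matrix.mulVec_mulVec]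
  rw [Matrix.add_mulVec, Matrix.add_mulVec, dotProduct_add, dotProduct_add, h2] at h1
  rw [h3]
  linarith

variable [DecidableEq V]

/-- Lyapunov's theorem: a matrix with a positive definite Lyapunov certificate is stable. -/
theorem isStableMatrix_of_lyapunov {M S C : Matrix V V ℝ} (hS : S.PosDef) (hC : C.PosDef)
    (h : M * S + S * Mᵀ + C = 0) : IsStableMatrix M := by
  intro z hz
  rw [spectrum.mem_iff, Matrix.isUnit_iff_isUnit_det, isUnit_iff_ne_zero, not_not,
    ← Matrix.exists_vecMul_eq_zero_iff] at hz
  obtain ⟨v, hv0, hv⟩ := hz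
  have hv' : v ᵥ* M.map (fun x : ℝ => (x : ℂ)) = z • v := by
    rw [Matrix.vecMul_sub, sub_eq_zero] at hv
    rw [← hv, Algebra.algebraMap_eq_smul_one, Matrix.vecMul_smul, Matrix.vecMul_one]
  set x : V → ℝ := fun i => (v i).re with hx
  set y : V → ℝ := fun i => (v i).im with hy
  have hxM : x ᵥ* M = z.re • x - z.im • y := by
    ext c
    have := congrArg Complex.re (congrFun hv' c)
    simpa [Matrix.vecMul, dotProduct, hx, hy] using this
  have hyM : y ᵥ* M = z.re • y + z.im • x := by
    ext c
    have := congrArg Complex.im (congrFun hv' c)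
    simpa [Matrix.vecMul, dotProduct, hx, hy] using this
  have q1 := two_mul_lyapunov_quadratic hS.transpose_eq h x
  have q2 := two_mul_lyapunov_quadratic hS.transpose_eq h y
  rw [hxM, sub_dotProduct, smul_dotProduct, smul_dotProduct] at q1
  rw [hyM, add_dotProduct, smul_dotProduct, smul_dotProduct] at q2
  -- The real and imaginary parts of a left eigenvector span an invariant space. In the sum of `q1`
  -- and `q2` the terms with `z.im` cancel by this symmetry, which leaves `z.re` times a positive
  -- number on one side and a negative number on the other.
  have hsymm : y ⬝ᵥ S *ᵥ x = x ⬝ᵥ S *ᵥ y := by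
    conv_lhs => rw [← hS.transpose_eq]
    rw [Matrix.mulVec_transpose, dotProduct_comm, ← Matrix.dotProduct_mulVec]
  have nonneg : ∀ {A : Matrix V V ℝ}, A.PosDef → ∀ w : V → ℝ, 0 ≤ w ⬝ᵥ A *ᵥ w := fun hA w => by
    by_cases hw : w = 0
    · simp [hw]
    · exact (hA.dotProduct_mulVec_pos_real hw).le
  have hne : x ≠ 0 ∨ y ≠ 0 := by
    by_contra! hcon
    apply hv0
    funext i
    exact Complex.ext (congrFun hcon.1 i) (congrFun hcon.2 i)
  have pos : ∀ {A : Matrix V V ℝ}, A.PosDef → 0 < x ⬝ᵥ A *ᵥ x + y ⬝ᵥ A *ᵥ y := fun hA => by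
    rcases hne with h0 | h0
    · linarith [hA.dotProduct_mulVec_pos_real h0, nonneg hA y]
    · linarith [hA.dotProduct_mulVec_pos_real h0, nonneg hA x]
  have hSp := pos hS
  have hCp := pos hC
  simp only [smul_eq_mul] at q1 q2
  rw [hsymm] at q1
  by_contra! hz
  nlinarith [mul_nonneg hz hSp.le]

/-- Stability drops out of the definition; what remains is linear in M once S is fixed. -/
theorem mem_lyapunovModel_iff {G : LoopedDigraph V} {S C : Matrix V V ℝ} (hC : C.PosDef) :
    S ∈ lyapunovModel G C ↔
      S.PosDef ∧ ∃ M : Matrix V V ℝ, IsSparseMatrix G M ∧ M * S + S * Mᵀ + C = 0 :=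
  ⟨fun ⟨hS, M, _, h⟩ => ⟨hS, M, h⟩,
    fun ⟨hS, M, hM, h⟩ => ⟨hS, M, isStableMatrix_of_lyapunov hS hC h, hM, h⟩⟩

/-- The regression vector: supported on `A`, with image under `S` equal to the `i`-th
unit vector on `A`. -/
theorem Matrix.PosDef.exists_regression {S : Matrix V V ℝ} (hS : S.PosDef) (A : Set V) {i : V}
    (hi : i ∈ A) :
    ∃ u : V → ℝ, (∀ k, k ∉ A → u k = 0) ∧ (∀ k ∈ A, (S *ᵥ u) k = if k = i then 1 else 0) ∧
      0 < u i := by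
  classical
  have hA : (S.submatrix (Subtype.val : A → V) Subtype.val).PosDef :=
    hS.submatrix Subtype.val_injective
  set T := S.submatrix (Subtype.val : A → V) Subtype.val with hT
  set w : A → ℝ := T⁻¹ *ᵥ Pi.single ⟨i, hi⟩ 1 with hw
  set u : V → ℝ := fun k => if h : k ∈ A then w ⟨k, h⟩ else 0 with hu
  have hu0 : ∀ k, k ∉ A → u k = 0 := fun k hk => by simp [hu, hk]
  have hSu : ∀ k ∈ A, (S *ᵥ u) k = if k = i then 1 else 0 := by
    intro k hk
    have h1 : (S *ᵥ u) k = (T *ᵥ w) ⟨k, hk⟩ := by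
      simp only [Matrix.mulVec, dotProduct, hT, Matrix.submatrix_apply]
      rw [← Finset.sum_subset (Finset.subset_univ (Finset.univ.filter (· ∈ A)))]
      · rw [Finset.sum_subtype (p := (· ∈ A)) _ (by simp)]
        refine Finset.sum_congr rfl fun a _ => ?_
        simp [hu]
      · intro a _ ha
        rw [hu0 a (by simpa using ha), mul_zero]
    rw [h1, hw, Matrix.mulVec_mulVec, Matrix.mul_nonsing_inv _
      ((Matrix.isUnit_iff_isUnit_det _).1 hA.isUnit), Matrix.one_mulVec, Pi.single_apply]
    simp [Subtype.ext_iff]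
  refine ⟨u, hu0, hSu, ?_⟩
  have hne : u ≠ 0 := by
    intro h0
    have := hSu i hi
    simp [h0] at this
  have hpos := hS.dotProduct_mulVec_pos_real hne
  -- The quadratic form at u is just `u i`: Su vanishes on A away from i, and u vanishes off A.
  rwa [dotProduct, Finset.sum_eq_single i, hSu i hi, if_pos rfl, mul_one] at hpos
  · intro k _ hk
    by_cases hkA : k ∈ A
    · rw [hSu k hkA, if_neg hk, mul_zero]
    · rw [hu0 k hkA, zero_mul]
  · simp

end Lyapunov

/-! ### Acyclicity and ancestral sets. -/

namespace LoopedDigraph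

variable {V : Type} {G : LoopedDigraph V}

theorem IsAcyclic.antisymm (hG : G.IsAcyclic) {a b : V} (h : G.Adj a b) (h' : G.Adj b a) :
    a = b := by
  by_contra hne
  exact hG a (.tail (.single ⟨hne, h⟩) ⟨Ne.symm hne, h'⟩)

theorem IsAcyclic.eq_of_triangle (hG : G.IsAcyclic) {a b c : V} (h : G.Adj a b)
    (h' : G.Adj b c) (h'' : G.Adj c a) : a = b ∧ b = c := by
  by_cases hab : a = b
  · subst hab
    exact ⟨rfl, hG.antisymm h' h''⟩
  by_cases hbc : b = c
  · subst hbc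
    exact ⟨hG.antisymm h h'', rfl⟩
  by_cases hca : c = a
  · subst hca
    exact absurd (hG.antisymm h h') hab
  exact absurd (.tail (.tail (.single ⟨hab, h⟩) ⟨hbc, h'⟩) ⟨hca, h''⟩) (hG a)

/-- `a` is a proper ancestor of `b`. -/
def Before (G : LoopedDigraph V) (a b : V) : Prop :=
  Relation.TransGen (fun a b => a ≠ b ∧ G.Adj a b) a b

theorem IsAcyclic.wellFounded_before [Finite V] (hG : G.IsAcyclic) : WellFounded G.Before := by
  have : IsTrans V G.Before := ⟨fun _ _ _ h h' => Relation.TransGen.trans h h'⟩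
  have : Std.Irrefl G.Before := ⟨hG⟩
  exact Finite.wellFounded_of_trans_of_irrefl _

/-- A set of vertices that contains the parents of its elements. -/
def IsAncestral (G : LoopedDigraph V) (A : Set V) : Prop :=
  ∀ a ∈ A, ∀ p, G.Adj p a → p ∈ A

end LoopedDigraph

/-! ### Covariances in acyclic models. -/

section Covariance

open LoopedDigraph

variable {V : Type} [Fintype V] [DecidableEq V] {G : LoopedDigraph V} {M S : Matrix V V ℝ}
  {c : V → ℝ}

/-- Take the regression vector u of a on a and its ancestors. Off this ancestral set uM vanishes,
and on it Su is the unit vector of a; no other vertex of the set is a child of a. So the quadratic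
identity reads 2 u(a) M(a,a) < 0, with u(a) > 0. -/
theorem diag_neg_of_lyapunov (hG : G.IsAcyclic) (hS : S.PosDef) (hc : ∀ i, 0 < c i)
    (hM : IsSparseMatrix G M) (h : M * S + S * Mᵀ + Matrix.diagonal c = 0) (a : V) :
    M a a < 0 := by
  set A : Set V := {k | k = a ∨ G.Before k a} with hA
  have hanc : ∀ k ∈ A, ∀ p, G.Adj p k → p ∈ A := by
    rintro k (rfl | hk) p hp
    · by_cases hpk : p = k
      · exact Or.inl hpk
      · exact Or.inr (.single ⟨hpk, hp⟩)
    · by_cases hpk : p = k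
      · exact hpk ▸ Or.inr hk
      · exact Or.inr (.head ⟨hpk, hp⟩ hk)
  obtain ⟨u, hu0, hSu, hua⟩ := hS.exists_regression A (i := a) (Or.inl rfl)
  have hq := two_mul_lyapunov_quadratic hS.transpose_eq h u
  have hne : u ≠ 0 := fun h0 => by simp [h0] at hua
  have hC := (Matrix.PosDef.diagonal hc).dotProduct_mulVec_pos_real hne
  have hl : (u ᵥ* M) ⬝ᵥ (S *ᵥ u) = u a * M a a := by
    rw [dotProduct, Finset.sum_eq_single a]
    · rw [hSu a (Or.inl rfl), if_pos rfl, mul_one, Matrix.vecMul, dotProduct,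
        Finset.sum_eq_single a]
      · intro r _ hr
        by_cases hrA : r ∈ A
        · rw [hM a r, mul_zero]
          intro har
          rcases hrA with rfl | hrA
          · exact hr rfl
          · exact hG a (.head ⟨Ne.symm hr, har⟩ hrA)
        · rw [hu0 r hrA, zero_mul]
      · simp
    · intro k _ hk
      by_cases hkA : k ∈ A
      · rw [hSu k hkA, if_neg hk, mul_zero]
      · have : (u ᵥ* M) k = 0 := by
          refine Finset.sum_eq_zero fun r _ => ?_
          by_cases hrA : r ∈ A
          · have : M r k = 0 := hM k r fun hkr => hkA (hanc r hrA k hkr)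
            simp [this]
          · rw [hu0 r hrA, zero_mul]
        rw [this, zero_mul]
    · simp
  rw [hl] at hq
  by_contra! hcon
  nlinarith [mul_nonneg hua.le hcon]

/-- Disjoint ancestral sets are uncorrelated. -/
theorem cov_eq_zero_of_isAncestral (hG : G.IsAcyclic) (hS : S.PosDef) (hc : ∀ i, 0 < c i)
    (hM : IsSparseMatrix G M) (h : M * S + S * Mᵀ + Matrix.diagonal c = 0) {A W : Set V}
    (hA : G.IsAncestral A) (hW : G.IsAncestral W) (hAW : Disjoint A W) :
    ∀ a ∈ A, ∀ w ∈ W, S a w = 0 := by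
  intro a
  induction a using hG.wellFounded_before.induction with
  | _ a iha =>
  intro ha w
  induction w using hG.wellFounded_before.induction with
  | _ w ihw =>
  intro hw
  have hne : a ≠ w := fun e => Set.disjoint_left.1 hAW ha (e ▸ hw)
  have he := congrFun (congrFun h a) w
  simp only [Matrix.add_apply, Matrix.mul_apply, Matrix.transpose_apply,
    Matrix.diagonal_apply_ne _ hne, Matrix.zero_apply, add_zero] at he
  -- By induction over proper ancestors of a and of w, every other covariance in this off-diagonal
  -- entry vanishes. What is left is (M(a,a) + M(w,w)) S(a,w) = 0, whose first factor is negative.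
  rw [Finset.sum_eq_single a, Finset.sum_eq_single w] at he
  · have h1 := diag_neg_of_lyapunov hG hS hc hM h a
    have h2 := diag_neg_of_lyapunov hG hS hc hM h w
    have h3 : (M a a + M w w) * S a w = 0 := by linarith
    exact (mul_eq_zero.1 h3).resolve_left (by linarith)
  · intro k _ hk
    by_cases hkw : G.Adj k w
    · rw [ihw k (.single ⟨hk, hkw⟩) (hW w hw k hkw), zero_mul]
    · rw [hM k w hkw, mul_zero]
  · simp
  · intro k _ hk
    by_cases hka : G.Adj k a
    · rw [iha k (.single ⟨hk, hka⟩) (hA a ha k hka) w hw, mul_zero]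
    · rw [hM k a hka, zero_mul]
  · simp

end Covariance

/-! ### Reversible edges and exchange of names. -/

namespace LoopedDigraph

variable {V : Type} {G H : LoopedDigraph V}

/-- `a` and `b` are equal or joined by an edge. -/
def Linked (G : LoopedDigraph V) (a b : V) : Prop :=
  G.Adj a b ∨ G.Adj b a

theorem Linked.symm {a b : V} (h : G.Linked a b) : G.Linked b a :=
  Or.symm h

/-- Among the paths of length two in the skeleton that start at `i` or have `i` in the middle,
the unshielded ones are colliders with an end at `i`, or have both edges pointing to `i`
or both edges pointing away from `i`. -/
def Local (G : LoopedDigraph V) (i : V) : Prop :=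
  ∀ a b, (G.Adj b a → G.Adj a i → G.Linked b i) ∧ (G.Adj i a → G.Adj a b → G.Linked b i) ∧
    (G.Adj a i → G.Adj a b → G.Linked b i) ∧ (G.Adj a i → G.Adj i b → G.Linked a b)

/-- The edge `i → j` can be reversed without changing the Lyapunov model. -/
structure Reversible (G : LoopedDigraph V) (i j : V) : Prop where
  ne : i ≠ j
  adj : G.Adj i j
  parent : ∀ k, k ≠ i → k ≠ j → (G.Adj k i ↔ G.Adj k j)
  child : ∀ k, k ≠ i → k ≠ j → (G.Adj i k ↔ G.Adj j k)
  loc : G.Local i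
  loc' : G.Local j

/-- The graph with vertices renamed by a permutation. -/
def relabel (s : Equiv.Perm V) (G : LoopedDigraph V) : LoopedDigraph V where
  Adj a b := G.Adj (s a) (s b)
  loop _ := G.loop _

theorem relabel_adj (s : Equiv.Perm V) (a b : V) :
    (relabel s G).Adj a b ↔ G.Adj (s a) (s b) := Iff.rfl

theorem IsAcyclic.relabel (hG : G.IsAcyclic) (s : Equiv.Perm V) : (relabel s G).IsAcyclic :=
  fun i h => hG (s i) (h.lift s fun _ _ hab => ⟨fun e => hab.1 (s.injective e), hab.2⟩)

theorem Reversible.relabel (s : Equiv.Perm V) {i j : V} (h : G.Reversible (s i) (s j)) :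
    (relabel s G).Reversible i j where
  ne e := h.ne (e ▸ rfl)
  adj := h.adj
  parent k hi hj := h.parent (s k) (s.injective.ne hi) (s.injective.ne hj)
  child k hi hj := h.child (s k) (s.injective.ne hi) (s.injective.ne hj)
  loc a b := h.loc (s a) (s b)
  loc' a b := h.loc' (s a) (s b)

variable [DecidableEq V]

theorem relabel_swap_relabel_swap (i j : V) :
    relabel (Equiv.swap i j) (relabel (Equiv.swap i j) G) = G := by
  ext a b
  simp [relabel_adj]

/-- As i and j share all their other parents and children, exchanging their names affects only the
edge between them. Reversal is thus a relabelling, under which acyclicity is evident. -/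
theorem Reversible.swap_adj_iff {i j : V} (h : G.Reversible i j) {a b : V}
    (h1 : ¬ (a = i ∧ b = j)) (h2 : ¬ (a = j ∧ b = i)) :
    (LoopedDigraph.relabel (Equiv.swap i j) G).Adj a b ↔ G.Adj a b := by
  rw [relabel_adj]
  have hp := h.parent
  have hc := h.child
  have hne := h.ne
  have hl := G.loop
  simp only [Equiv.swap_apply_def]
  by_cases hai : a = i <;> by_cases haj : a = j <;> by_cases hbi : b = i <;>
    by_cases hbj : b = j <;> simp_all

theorem Reversible.swap_adj {i j : V} (_ : G.Reversible i j) :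
    (LoopedDigraph.relabel (Equiv.swap i j) G).Adj i j ↔ G.Adj j i := by
  simp [relabel_adj]

theorem Reversible.swap_adj' {i j : V} (_ : G.Reversible i j) :
    (LoopedDigraph.relabel (Equiv.swap i j) G).Adj j i ↔ G.Adj i j := by
  simp [relabel_adj]

theorem Reversible.swap_linked_iff {i j : V} (h : G.Reversible i j) {a b : V} :
    (LoopedDigraph.relabel (Equiv.swap i j) G).Linked a b ↔ G.Linked a b := by
  by_cases h1 : a = i ∧ b = j
  · obtain ⟨rfl, rfl⟩ := h1
    simp only [Linked, h.swap_adj, h.swap_adj', or_comm]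
  by_cases h2 : a = j ∧ b = i
  · obtain ⟨rfl, rfl⟩ := h2
    simp only [Linked, h.swap_adj, h.swap_adj', or_comm]
  · rw [Linked, Linked, h.swap_adj_iff h1 h2,
      h.swap_adj_iff (fun e => h2 ⟨e.2, e.1⟩) (fun e => h1 ⟨e.2, e.1⟩)]

end LoopedDigraph

/-! ### Invariance of the model under reversal of an edge. -/

section Reversal

open LoopedDigraph

variable {V : Type} {G : LoopedDigraph V} {i j : V}

/-- The parents of `i`, with `i` and `j`. -/
def reversalBase (G : LoopedDigraph V) (i j : V) : Set V :=
  {k | G.Adj k i ∨ k = j}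

/-- For p → a → i the condition `Local i` links p to i, and acyclicity leaves only p → i. The
parents of j besides i and j are parents of i. -/
theorem LoopedDigraph.Reversible.isAncestral_base (hG : G.IsAcyclic) (h : G.Reversible i j) :
    G.IsAncestral (reversalBase G i j) := by
  have key : ∀ a p, G.Adj a i → G.Adj p a → p ∈ reversalBase G i j := by
    intro a p ha hp
    rcases (h.loc a p).1 hp ha with hl | hl
    · exact Or.inl hl
    · obtain ⟨rfl, rfl⟩ := hG.eq_of_triangle hl hp ha
      exact Or.inl (G.loop _)
  rintro a (ha | rfl) p hp
  · exact key a p ha hp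
  · by_cases hpi : p = i
    · exact Or.inl (hpi ▸ G.loop _)
    by_cases hpj : p = a
    · exact Or.inr hpj
    exact Or.inl ((h.parent p hpi hpj).2 hp)

/-- If a parent p of w were a parent or a child of i, then `Local i` would link w to i; if p were j,
then w would be a child of i because children are shared. -/
theorem LoopedDigraph.Reversible.isAncestral_rest (h : G.Reversible i j) :
    G.IsAncestral {w | w ∉ reversalBase G i j ∧ ¬ G.Adj i w} := by
  rintro w ⟨hwA, hiw⟩ p hp
  have hwi : ¬ G.Adj w i := fun e => hwA (Or.inl e)
  have hwj : w ≠ j := fun e => hwA (Or.inr e)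
  have hnl : ¬ G.Linked w i := fun e => e.elim hwi hiw
  refine ⟨?_, fun hip => hnl ((h.loc p w).2.1 hip hp)⟩
  rintro (hpi | rfl)
  · exact hnl ((h.loc p w).2.2.1 hpi hp)
  · exact hiw ((h.child w (fun e => hiw (e ▸ G.loop _)) hwj).2 hp)

variable [Fintype V] [DecidableEq V] {c : V → ℝ}

/-- With x = Su and y = Sw, the matrix K = xwᵀ − yuᵀ satisfies KS = xyᵀ − yxᵀ, which is
skew-symmetric, so multiples of K may be added to M. The columns of K are supported on A, its rows
on i, j and the children of i; `Reversible` makes the reversed graph contain all these edges except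
i → j. -/
theorem lyapunovModel_subset_swap (hc : ∀ k, 0 < c k) (hG : G.IsAcyclic)
    (h : G.Reversible i j) :
    lyapunovModel G (Matrix.diagonal c) ⊆
      lyapunovModel (relabel (Equiv.swap i j) G) (Matrix.diagonal c) := by
  rintro S ⟨hS, M, -, hM, hMS⟩
  rw [mem_lyapunovModel_iff (Matrix.PosDef.diagonal hc)]
  refine ⟨hS, ?_⟩
  set A := reversalBase G i j with hA
  have hiA : i ∈ A := Or.inl (G.loop i)
  have hjA : j ∈ A := Or.inr rfl
  obtain ⟨u, hu0, hSu, hui⟩ := hS.exists_regression A hiA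
  obtain ⟨w, hw0, hSw, -⟩ := hS.exists_regression A hjA
  have hcov := cov_eq_zero_of_isAncestral hG hS hc hM hMS (h.isAncestral_base hG)
    h.isAncestral_rest (Set.disjoint_left.2 fun a ha hw => hw.1 ha)
  have hrest : ∀ v : V → ℝ, (∀ k, k ∉ A → v k = 0) → ∀ r, r ∉ A → ¬ G.Adj i r →
      (S *ᵥ v) r = 0 := by
    intro v hv r hrA hir
    refine Finset.sum_eq_zero fun k _ => ?_
    by_cases hk : k ∈ A
    · have : S r k = 0 := by
        rw [← hS.transpose_eq, Matrix.transpose_apply]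
        exact hcov k hk r ⟨hrA, hir⟩
      simp [this]
    · simp [hv k hk]
  set x := S *ᵥ u with hx
  set y := S *ᵥ w with hy
  -- The entry of K at row j and column i is −u(i), so this factor cancels the coefficient of i → j.
  set t := M j i / u i with ht
  have hK : ∀ v z : V → ℝ, Matrix.vecMulVec v z * S = Matrix.vecMulVec v (S *ᵥ z) := by
    intro v z
    rw [Matrix.vecMulVec_mul]
    conv_lhs => rw [← hS.transpose_eq, Matrix.vecMul_transpose]
  have hK' : ∀ v z : V → ℝ, S * (Matrix.vecMulVec v z)ᵀ = Matrix.vecMulVec (S *ᵥ z) v := by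
    intro v z
    rw [Matrix.transpose_vecMulVec, Matrix.mul_vecMulVec]
  refine ⟨M + t • (Matrix.vecMulVec x w - Matrix.vecMulVec y u), ?_, ?_⟩
  · intro a r har
    simp only [Matrix.add_apply, Matrix.smul_apply, Matrix.sub_apply, Matrix.vecMulVec_apply,
      smul_eq_mul]
    by_cases h1 : a = i ∧ r = j
    · obtain ⟨rfl, rfl⟩ := h1
      rw [hSu _ hjA, hSw _ hjA, if_neg h.ne.symm, if_pos rfl, ht]
      field_simp
      ring
    have h2 : ¬ (a = j ∧ r = i) := by
      rintro ⟨rfl, rfl⟩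
      exact har (h.swap_adj'.2 h.adj)
    rw [h.swap_adj_iff h1 h2] at har
    rw [hM a r har]
    by_cases haA : a ∈ A
    swap
    · rw [hu0 a haA, hw0 a haA]; ring
    have hri : r ≠ i := by
      rintro rfl
      rcases haA with haA | rfl
      · exact har haA
      · exact h2 ⟨rfl, rfl⟩
    have hrj : r ≠ j := by
      rintro rfl
      rcases haA with haA | rfl
      · by_cases hai : a = i
        · exact h1 ⟨hai, rfl⟩
        · exact har ((h.parent a hai (fun e => har (e ▸ G.loop _))).1 haA)
      · exact har (G.loop _)
    by_cases hrA : r ∈ A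
    · rw [hSu r hrA, hSw r hrA, if_neg hri, if_neg hrj]; ring
    by_cases hir : G.Adj i r
    · exfalso
      -- Row r belongs to a child of i outside A: a parent a of i is linked to r by `Local i`,
      -- necessarily as a → r, and a = j has r as a common child with i.
      rcases haA with haA | rfl
      · rcases (h.loc a r).2.2.2 haA hir with hl | hl
        · exact har hl
        · obtain ⟨rfl, rfl⟩ := hG.eq_of_triangle hl haA hir
          exact har (G.loop _)
      · exact har ((h.child r hri hrj).1 hir)
    · have hxr : x r = 0 := hrest u hu0 r hrA hir
      have hyr : y r = 0 := hrest w hw0 r hrA hir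
      rw [hxr, hyr]; ring
  · rw [add_mul, Matrix.transpose_add, mul_add, Matrix.smul_mul, Matrix.transpose_smul,
      Matrix.mul_smul, sub_mul, Matrix.transpose_sub, mul_sub, hK, hK, hK', hK', ← hMS]
    simp only [← hx, ← hy]
    module

theorem lyapunovModel_swap (hc : ∀ k, 0 < c k) (hG : G.IsAcyclic) (h : G.Reversible i j) :
    lyapunovModel (relabel (Equiv.swap i j) G) (Matrix.diagonal c) =
      lyapunovModel G (Matrix.diagonal c) := by
  refine Set.Subset.antisymm ?_ (lyapunovModel_subset_swap hc hG h)
  have h' : (relabel (Equiv.swap i j) G).Reversible j i :=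
    Reversible.relabel _ (by simpa using h)
  have := lyapunovModel_subset_swap hc (hG.relabel (Equiv.swap i j)) h'
  rwa [Equiv.swap_comm j i, relabel_swap_relabel_swap] at this

end Reversal

/-! ### Sufficiency of the local criterion. -/

namespace LoopedDigraph

variable {V : Type} {G H : LoopedDigraph V}

/-- The local criterion for model equivalence. -/
structure LocallyEquivalent (G H : LoopedDigraph V) : Prop where
  linked : ∀ a b, G.Linked a b ↔ H.Linked a b
  twin : ∀ i j, i ≠ j → G.Adj i j → H.Adj j i → ∀ k, G.Linked i k ↔ G.Linked j k
  loc : ∀ i j, i ≠ j → G.Adj i j → H.Adj j i → G.Local i ∧ G.Local j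

/-- The edges of `G` that are reversed in `H`. -/
def reversedEdges (G H : LoopedDigraph V) : Set (V × V) :=
  {e | e.1 ≠ e.2 ∧ G.Adj e.1 e.2 ∧ H.Adj e.2 e.1}

theorem LocallyEquivalent.eq_of_reversedEdges_eq_empty (h : LocallyEquivalent G H)
    (he : reversedEdges G H = ∅) : G = H := by
  have he' : ∀ a b, a ≠ b → G.Adj a b → H.Adj b a → False := fun a b h1 h2 h3 =>
    (Set.ext_iff.1 he (a, b)).1 ⟨h1, h2, h3⟩
  ext a b
  by_cases hab : a = b
  · subst hab
    exact ⟨fun _ => H.loop _, fun _ => G.loop _⟩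
  constructor
  · intro h1
    rcases (h.linked a b).1 (Or.inl h1) with h2 | h2
    · exact h2
    · exact (he' a b hab h1 h2).elim
  · intro h1
    rcases (h.linked a b).2 (Or.inl h1) with h2 | h2
    · exact h2
    · exact (he' b a (Ne.symm hab) h2 h1).elim

/-- Choose a reversed edge i → j with the fewest vertices k such that i → k → j. If such a k
existed, H would have to reverse i → k or k → j to avoid a cycle with j → i, and that edge has
strictly fewer vertices in between. Without such k, equal neighbourhoods and acyclicity force equal
parents and equal children. -/
theorem LocallyEquivalent.exists_reversible [Finite V] (h : LocallyEquivalent G H)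
    (hG : G.IsAcyclic) (hH : H.IsAcyclic) (he : (reversedEdges G H).Nonempty) :
    ∃ i j, G.Reversible i j ∧ H.Adj j i := by
  set between : V × V → Set V := fun e => {k | k ≠ e.1 ∧ k ≠ e.2 ∧ G.Adj e.1 k ∧ G.Adj k e.2}
    with hbet
  obtain ⟨⟨i, j⟩, ⟨hne, hij, hji⟩, hmin⟩ :=
    exists_minimalFor_of_wellFoundedLT (· ∈ reversedEdges G H) (fun e => (between e).ncard) he
  dsimp only at hne hij hji
  have htw := h.twin i j hne hij hji
  have hempty : ∀ k, k ≠ i → k ≠ j → G.Adj i k → G.Adj k j → False := by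
    intro k hki hkj hik hkj'
    have hk : k ∈ between (i, j) := ⟨hki, hkj, hik, hkj'⟩
    -- Minimality in usable form: an edge whose set of intermediate vertices lies in that of i → j
    -- and misses k is not reversed.
    have hlt : ∀ e, between e ⊆ between (i, j) → k ∉ between e → e ∉ reversedEdges G H := by
      intro e hsub hke hmem
      have h1 : (between e).ncard < (between (i, j)).ncard :=
        Set.ncard_lt_ncard ⟨hsub, fun hs => hke (hs hk)⟩ (Set.toFinite _)
      exact absurd (hmin hmem h1.le) (not_le.2 h1)
    rcases (h.linked i k).1 (Or.inl hik) with hl | hl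
    · rcases (h.linked k j).1 (Or.inl hkj') with hl' | hl'
      · exact hki (hH.eq_of_triangle hji hl hl').2.symm
      · refine hlt (k, j) ?_ (fun hm => hm.1 rfl) ⟨hkj, hkj', hl'⟩
        rintro m ⟨hmk, hmj, hkm, hmj'⟩
        have hmi : m ≠ i := by
          rintro rfl
          exact hmk (hG.antisymm hik hkm)
        refine ⟨hmi, hmj, ?_, hmj'⟩
        rcases (htw m).2 (Or.inr hmj') with h1 | h1
        · exact h1
        · exact absurd (hG.eq_of_triangle h1 hik hkm).1 hmi
    · refine hlt (i, k) ?_ (fun hm => hm.2.1 rfl) ⟨Ne.symm hki, hik, hl⟩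
      rintro m ⟨hmi, hmk, him, hmk'⟩
      have hmj : m ≠ j := by
        rintro rfl
        exact hmk (hG.antisymm hmk' hkj')
      refine ⟨hmi, hmj, him, ?_⟩
      rcases (htw m).1 (Or.inl him) with h1 | h1
      · exact absurd (hG.eq_of_triangle h1 hmk' hkj').2 (Ne.symm hmk ∘ Eq.symm)
      · exact h1
  refine ⟨i, j, ⟨hne, hij, fun k hki hkj => ⟨fun hk => ?_, fun hk => ?_⟩,
    fun k hki hkj => ⟨fun hk => ?_, fun hk => ?_⟩, (h.loc i j hne hij hji).1,
    (h.loc i j hne hij hji).2⟩, hji⟩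
  · rcases (htw k).1 (Or.inr hk) with h1 | h1
    · exact absurd (hG.eq_of_triangle hk hij h1).1 hki
    · exact h1
  · rcases (htw k).2 (Or.inr hk) with h1 | h1
    · exact (hempty k hki hkj h1 hk).elim
    · exact h1
  · rcases (htw k).1 (Or.inl hk) with h1 | h1
    · exact h1
    · exact (hempty k hki hkj hk h1).elim
  · rcases (htw k).2 (Or.inl hk) with h1 | h1
    · exact h1
    · exact absurd (hG.eq_of_triangle hij hk h1).2 (Ne.symm hkj)

variable [DecidableEq V]

theorem Reversible.reversedEdges_swap_ssubset {i j : V} (h : G.Reversible i j)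
    (hG : G.IsAcyclic) (hH : H.IsAcyclic) (hji : H.Adj j i) :
    reversedEdges (LoopedDigraph.relabel (Equiv.swap i j) G) H ⊂ reversedEdges G H := by
  refine ⟨?_, fun hs => ?_⟩
  · rintro ⟨a, b⟩ ⟨h1, h2, h3⟩
    dsimp only at h1 h2 h3
    by_cases e1 : a = i ∧ b = j
    · obtain ⟨rfl, rfl⟩ := e1
      exact ⟨h1, h.adj, h3⟩
    by_cases e2 : a = j ∧ b = i
    · obtain ⟨rfl, rfl⟩ := e2
      exact absurd (hH.antisymm h3 hji) h.ne
    · exact ⟨h1, (h.swap_adj_iff e1 e2).1 h2, h3⟩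
  · have hm : (i, j) ∈ reversedEdges G H := ⟨h.ne, h.adj, hji⟩
    exact h.ne (hG.antisymm h.adj (h.swap_adj.1 (hs hm).2.1))

/-- A path of length two through the edge between i and j is shielded, because these two vertices
have the same neighbours; every other path keeps its orientation. -/
theorem Reversible.local_swap {i j : V} (h : G.Reversible i j)
    (htw : ∀ k, G.Linked i k ↔ G.Linked j k) {x : V} (hx : G.Local x) :
    (LoopedDigraph.relabel (Equiv.swap i j) G).Local x := by
  have htw' : ∀ k, G.Linked k i ↔ G.Linked k j := fun k =>
    ⟨fun e => ((htw k).1 e.symm).symm, fun e => ((htw k).2 e.symm).symm⟩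
  have key : ∀ p q r, ((p = i ∧ q = j ∨ p = j ∧ q = i) ∨ (q = i ∧ r = j ∨ q = j ∧ r = i)) →
      G.Linked p q → G.Linked q r → G.Linked p r := by
    rintro p q r ((⟨rfl, rfl⟩ | ⟨rfl, rfl⟩) | (⟨rfl, rfl⟩ | ⟨rfl, rfl⟩)) h1 h2
    · exact (htw r).2 h2
    · exact (htw r).1 h2
    · exact (htw' p).1 h1
    · exact (htw' p).2 h1
  have edge : ∀ {p q}, (LoopedDigraph.relabel (Equiv.swap i j) G).Adj p q →
      G.Linked p q ∧ (G.Adj p q ∨ (p = i ∧ q = j ∨ p = j ∧ q = i)) := by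
    intro p q hpq
    refine ⟨h.swap_linked_iff.1 (Or.inl hpq), ?_⟩
    by_cases e1 : p = i ∧ q = j
    · exact Or.inr (Or.inl e1)
    by_cases e2 : p = j ∧ q = i
    · exact Or.inr (Or.inr e2)
    · exact Or.inl ((h.swap_adj_iff e1 e2).1 hpq)
  intro a b
  simp only [h.swap_linked_iff]
  refine ⟨fun h1 h2 => ?_, fun h1 h2 => ?_, fun h1 h2 => ?_, fun h1 h2 => ?_⟩
  all_goals
    obtain ⟨l1, h1 | h1⟩ := edge h1 <;> obtain ⟨l2, h2 | h2⟩ := edge h2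
  · exact (hx a b).1 h1 h2
  · exact key _ _ _ (Or.inr h2) l1 l2
  · exact key _ _ _ (Or.inl h1) l1 l2
  · exact key _ _ _ (Or.inl h1) l1 l2
  · exact (hx a b).2.1 h1 h2
  · exact (key _ _ _ (Or.inr h2) l1 l2).symm
  · exact (key _ _ _ (Or.inl h1) l1 l2).symm
  · exact (key _ _ _ (Or.inl h1) l1 l2).symm
  · exact (hx a b).2.2.1 h1 h2
  · exact (key x a b (Or.inr h2) l1.symm l2).symm
  · exact (key x a b (Or.inl (by tauto)) l1.symm l2).symm
  · exact (key x a b (Or.inl (by tauto)) l1.symm l2).symm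
  · exact (hx a b).2.2.2 h1 h2
  · exact key _ _ _ (Or.inr h2) l1 l2
  · exact key _ _ _ (Or.inl h1) l1 l2
  · exact key _ _ _ (Or.inl h1) l1 l2

/-- The skeleton is unchanged and no new edge becomes reversed, so the conditions at the remaining
reversed edges are inherited. -/
theorem LocallyEquivalent.swap (h : LocallyEquivalent G H) {i j : V} (hr : G.Reversible i j)
    (hG : G.IsAcyclic) (hH : H.IsAcyclic) (hji : H.Adj j i) :
    LocallyEquivalent (LoopedDigraph.relabel (Equiv.swap i j) G) H := by
  have hsub : ∀ a b, a ≠ b → (LoopedDigraph.relabel (Equiv.swap i j) G).Adj a b → H.Adj b a →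
      G.Adj a b := fun a b h1 h2 h3 =>
    ((hr.reversedEdges_swap_ssubset hG hH hji).1
      (show (a, b) ∈ reversedEdges _ H from ⟨h1, h2, h3⟩)).2.1
  have htw := h.twin i j hr.ne hr.adj hji
  refine ⟨fun a b => hr.swap_linked_iff.trans (h.linked a b), ?_, ?_⟩
  · intro a b hab h1 h2 k
    rw [hr.swap_linked_iff, hr.swap_linked_iff]
    exact h.twin a b hab (hsub a b hab h1 h2) h2 k
  · intro a b hab h1 h2
    obtain ⟨l1, l2⟩ := h.loc a b hab (hsub a b hab h1 h2) h2
    exact ⟨hr.local_swap htw l1, hr.local_swap htw l2⟩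

end LoopedDigraph

open LoopedDigraph in
-- Induction on the number of reversed edges: each reversal keeps the model and removes one
-- disagreement with H.
theorem LoopedDigraph.LocallyEquivalent.lyapunovModel_eq {V : Type} [Fintype V] [DecidableEq V]
    {G H : LoopedDigraph V} {c : V → ℝ} (hc : ∀ k, 0 < c k) (hG : G.IsAcyclic)
    (hH : H.IsAcyclic) (h : LocallyEquivalent G H) :
    lyapunovModel G (Matrix.diagonal c) = lyapunovModel H (Matrix.diagonal c) := by
  induction hn : (reversedEdges G H).ncard using Nat.strong_induction_on generalizing G with
  | _ n ih =>
  rcases (reversedEdges G H).eq_empty_or_nonempty with he | he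
  · rw [h.eq_of_reversedEdges_eq_empty he]
  · obtain ⟨i, j, hr, hji⟩ := h.exists_reversible hG hH he
    rw [← lyapunovModel_swap hc hG hr]
    exact ih _ (hn ▸ Set.ncard_lt_ncard (hr.reversedEdges_swap_ssubset hG hH hji)
      (Set.toFinite _)) (hG.relabel _) (h.swap hr hG hH hji) rfl

/-- A graph without reversible edges is not locally equivalent to any other DAG, and conversely
the reversal of an edge leads to another DAG with the same model. -/
theorem LoopedDigraph.LocallyEquivalent.eq_of_forall_not_reversible {V : Type} [Finite V]
    {G H : LoopedDigraph V} (hG : G.IsAcyclic) (hH : H.IsAcyclic) (h : LocallyEquivalent G H)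
    (hr : ∀ i j, ¬ G.Reversible i j) : G = H := by
  rcases (reversedEdges G H).eq_empty_or_nonempty with he | he
  · exact h.eq_of_reversedEdges_eq_empty he
  · obtain ⟨i, j, hr', -⟩ := h.exists_reversible hG hH he
    exact absurd hr' (hr i j)

/-! ### Induced subgraphs. -/

namespace LoopedDigraph

/-- The graph induced along a map. -/
def comap {U V : Type} (f : U → V) (G : LoopedDigraph V) : LoopedDigraph U where
  Adj a b := G.Adj (f a) (f b)
  loop _ := G.loop _

end LoopedDigraph

section Induced

variable {U V : Type} [Fintype U] [DecidableEq U] [Fintype V] [DecidableEq V]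

/-- Inclusion of models passes to induced subgraphs, where the volatility matrix may be
normalised to the identity. -/
theorem exists_sparse_of_lyapunovModel_subset {G H : LoopedDigraph V} {c : V → ℝ}
    (hc : ∀ k, 0 < c k)
    (hsub : lyapunovModel G (Matrix.diagonal c) ⊆ lyapunovModel H (Matrix.diagonal c))
    {f : U → V} (hf : Function.Injective f) {T N : Matrix U U ℝ} (hT : T.PosDef)
    (hN : IsSparseMatrix (G.comap f) N) (h : N * T + T * Nᵀ + 1 = 0) :
    ∃ N' : Matrix U U ℝ, IsSparseMatrix (H.comap f) N' ∧ N' * T + T * N'ᵀ + 1 = 0 := by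
  classical
  -- E embeds the small space, scaled by √c to turn the identity into C; Fᵀ is a left inverse of E,
  -- and Q projects onto the vertices outside the range of f. The covariance `E * T * Eᵀ + Q` makes
  -- these vertices independent with variance 1.
  set E : Matrix V U ℝ := Matrix.of fun a x => if a = f x then √(c a) else 0 with hE
  set F : Matrix V U ℝ := Matrix.of fun a x => if a = f x then (√(c a))⁻¹ else 0 with hF
  set q : V → ℝ := fun a => if a ∈ Set.range f then 0 else 1 with hq
  set Q : Matrix V V ℝ := Matrix.diagonal q with hQ
  set C : Matrix V V ℝ := Matrix.diagonal c with hCdef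
  have hC : C.PosDef := Matrix.PosDef.diagonal hc
  have hs : ∀ a, √(c a) ≠ 0 := fun a => (Real.sqrt_pos.2 (hc a)).ne'
  have hFE : Fᵀ * E = 1 := by
    ext x y
    simp only [Matrix.mul_apply, Matrix.transpose_apply, hE, hF, Matrix.of_apply, ite_mul,
      zero_mul, Finset.sum_ite_eq', Finset.mem_univ, if_true, Matrix.one_apply,
      hf.eq_iff]
    split_ifs <;> simp [hs]
  have hQE : Q * E = 0 := by
    ext a x
    simp only [hQ, hq, hE, Matrix.diagonal_mul, Matrix.of_apply, Matrix.zero_apply]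
    split_ifs with h1 h2 <;> simp_all
  have hQF : Q * F = 0 := by
    ext a x
    simp only [hQ, hq, hF, Matrix.diagonal_mul, Matrix.of_apply, Matrix.zero_apply]
    split_ifs with h1 h2 <;> simp_all
  have hQT : Qᵀ = Q := Matrix.diagonal_transpose _
  have hCT : Cᵀ = C := Matrix.diagonal_transpose _
  have hQQ : Q * Q = Q := by
    rw [hQ, Matrix.diagonal_mul_diagonal]
    congr 1
    ext a
    simp only [hq]
    split_ifs <;> simp
  have hQC : Q * C = C * Q := by
    rw [hQ, hCdef, Matrix.diagonal_mul_diagonal, Matrix.diagonal_mul_diagonal]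
    simp only [mul_comm]
  have hFQ : Fᵀ * Q = 0 := by
    rw [← Matrix.transpose_transpose Q, ← Matrix.transpose_mul, hQT, hQF, Matrix.transpose_zero]
  have hEQ : Eᵀ * Q = 0 := by
    rw [← Matrix.transpose_transpose Q, ← Matrix.transpose_mul, hQT, hQE, Matrix.transpose_zero]
  have hEE : E * Eᵀ = C - Q * C := by
    ext a b
    simp only [Matrix.mul_apply, Matrix.transpose_apply, Matrix.sub_apply, hQ, hCdef,
      Matrix.diagonal_mul_diagonal, Matrix.diagonal_apply, hE, hq, Matrix.of_apply]
    by_cases ha : a ∈ Set.range f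
    · obtain ⟨x, rfl⟩ := ha
      simp only [hf.eq_iff, ite_mul, zero_mul, Finset.sum_ite_eq, Finset.mem_univ, if_true,
        Set.mem_range_self]
      by_cases hb : b = f x
      · subst hb
        simp [Real.mul_self_sqrt (hc _).le]
      · simp [hb, Ne.symm hb]
    · have : ∀ x, a ≠ f x := fun x e => ha ⟨x, e.symm⟩
      simp [ha, this]
  have hFCF : Fᵀ * C * F = 1 := by
    have h1 : Fᵀ * (E * Eᵀ) * F = 1 := by
      have h2 : Eᵀ * F = 1 := by
        rw [← Matrix.transpose_transpose F, ← Matrix.transpose_mul, hFE, Matrix.transpose_one]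
      rw [← Matrix.mul_assoc, hFE, Matrix.one_mul, h2]
    rwa [hEE, Matrix.mul_sub, ← Matrix.mul_assoc Fᵀ Q, hFQ, Matrix.zero_mul, sub_zero] at h1
  have hS : (E * T * Eᵀ + Q).PosDef := by
    have hTs : Tᵀ = T := hT.transpose_eq
    refine Matrix.PosDef.of_dotProduct_mulVec_pos ?_ ?_
    · rw [Matrix.IsHermitian, Matrix.conjTranspose_eq_transpose_of_trivial, Matrix.transpose_add,
        Matrix.transpose_mul, Matrix.transpose_mul, Matrix.transpose_transpose, hTs, hQT,
        Matrix.mul_assoc]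
    · intro x hx
      have e1 : x ⬝ᵥ (E * T * Eᵀ) *ᵥ x = (Eᵀ *ᵥ x) ⬝ᵥ T *ᵥ (Eᵀ *ᵥ x) := by
        rw [Matrix.mul_assoc, ← Matrix.mulVec_mulVec, ← Matrix.mulVec_mulVec,
          Matrix.dotProduct_mulVec, Matrix.mulVec_transpose]
      have e2 : x ⬝ᵥ Q *ᵥ x = ∑ a, q a * x a ^ 2 := by
        simp only [hQ, dotProduct, Matrix.mulVec_diagonal]
        exact Finset.sum_congr rfl fun a _ => by ring
      have hq0 : ∀ a, 0 ≤ q a * x a ^ 2 := fun a => by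
        simp only [hq]
        split_ifs <;> positivity
      rw [star_trivial, Matrix.add_mulVec, dotProduct_add, e1, e2]
      by_cases h0 : Eᵀ *ᵥ x = 0
      · rw [h0]
        simp only [Matrix.mulVec_zero, dotProduct_zero, zero_add]
        obtain ⟨a, ha⟩ := Function.ne_iff.1 hx
        refine Finset.sum_pos' (fun a _ => hq0 a) ⟨a, Finset.mem_univ _, ?_⟩
        have har : a ∉ Set.range f := by
          rintro ⟨y, rfl⟩
          have := congrFun h0 y
          simp only [Matrix.mulVec, dotProduct, Matrix.transpose_apply, hE, Matrix.of_apply,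
            ite_mul, zero_mul, Finset.sum_ite_eq', Finset.mem_univ, if_true,
            Pi.zero_apply] at this
          exact ha ((mul_eq_zero.1 this).resolve_left (hs _))
        have ha' : x a ≠ 0 := ha
        simp only [hq, if_neg har, one_mul]
        positivity
      · have := hT.dotProduct_mulVec_pos_real h0
        have := Finset.sum_nonneg fun a (_ : a ∈ Finset.univ) => hq0 a
        linarith
  have hmem : E * T * Eᵀ + Q ∈ lyapunovModel G C := by
    rw [mem_lyapunovModel_iff hC]
    -- An isolated vertex a of variance 1 solves its own equation with coefficient −c(a)/2.
    refine ⟨hS, E * N * Fᵀ - (1 / 2 : ℝ) • (Q * C), ?_, ?_⟩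
    · intro a b hab
      have h1 : a ≠ b := fun e => hab (e ▸ G.loop _)
      have h2 : (Q * C) b a = 0 := by
        rw [hQ, hCdef, Matrix.diagonal_mul_diagonal, Matrix.diagonal_apply_ne _ h1.symm]
      rw [Matrix.sub_apply, Matrix.smul_apply, h2, smul_zero, sub_zero, Matrix.mul_apply]
      refine Finset.sum_eq_zero fun x _ => ?_
      rw [Matrix.transpose_apply, Matrix.mul_apply]
      by_cases hax : a = f x
      · rw [Finset.sum_eq_zero, zero_mul]
        intro y _
        by_cases hby : b = f y
        · have : N y x = 0 := hN x y (by subst hax hby; exact hab)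
          rw [this, mul_zero]
        · simp [hE, hby]
      · simp [hF, hax]
    · have e1 : (E * N * Fᵀ - (1 / 2 : ℝ) • (Q * C)) * (E * T * Eᵀ + Q) =
          E * (N * T) * Eᵀ - (1 / 2 : ℝ) • (Q * C) := by
        have f1 : E * N * Fᵀ * (E * T * Eᵀ) = E * (N * T) * Eᵀ := by
          calc _ = E * N * (Fᵀ * E) * T * Eᵀ := by simp only [Matrix.mul_assoc]
            _ = _ := by rw [hFE, Matrix.mul_one]; simp only [Matrix.mul_assoc]
        have f2 : E * N * Fᵀ * Q = 0 := by rw [Matrix.mul_assoc, hFQ, Matrix.mul_zero]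
        have f3 : Q * C * (E * T * Eᵀ) = 0 := by
          rw [hQC, Matrix.mul_assoc, Matrix.mul_assoc E, ← Matrix.mul_assoc Q, hQE,
            Matrix.zero_mul, Matrix.mul_zero]
        have f4 : Q * C * Q = Q * C := by rw [Matrix.mul_assoc, ← hQC, ← Matrix.mul_assoc, hQQ]
        rw [Matrix.mul_add, Matrix.sub_mul, Matrix.sub_mul, f1, f2, Matrix.smul_mul,
          Matrix.smul_mul, f3, f4]
        simp
        abel
      have e2 : (E * T * Eᵀ + Q) * (E * N * Fᵀ - (1 / 2 : ℝ) • (Q * C))ᵀ =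
          E * (T * Nᵀ) * Eᵀ - (1 / 2 : ℝ) • (Q * C) := by
        have := congrArg Matrix.transpose e1
        rw [Matrix.transpose_mul, hS.transpose_eq] at this
        rw [this]
        simp only [Matrix.transpose_sub, Matrix.transpose_smul, Matrix.transpose_mul,
          Matrix.transpose_transpose, hT.transpose_eq, hQT, hCT, hQC, Matrix.mul_assoc]
      have e3 : N * T + T * Nᵀ = -1 := eq_neg_of_add_eq_zero_left h
      rw [e1, e2]
      calc _ = E * (N * T + T * Nᵀ) * Eᵀ - Q * C + C := by
              rw [Matrix.mul_add, Matrix.add_mul]; module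
        _ = 0 := by
              rw [e3, Matrix.mul_neg, Matrix.neg_mul, Matrix.mul_one, hEE]; abel
  obtain ⟨-, M, -, hM, hMS⟩ := hsub hmem
  -- Compressing the large equation by Fᵀ and F gives the small one: the covariance has no block
  -- between the range of f and its complement, so entries of M across the two do not contribute.
  refine ⟨Fᵀ * M * E, ?_, ?_⟩
  · intro x y hxy
    rw [Matrix.mul_apply]
    refine Finset.sum_eq_zero fun a _ => ?_
    rw [Matrix.mul_apply]
    by_cases hax : a = f x
    · rw [Finset.sum_eq_zero, zero_mul]
      intro b _
      by_cases hby : b = f y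
      · have : M b a = 0 := hM a b (by subst hax hby; exact hxy)
        rw [this, mul_zero]
      · simp [hF, hby]
    · simp [hE, hax]
  · have hEF : Eᵀ * F = 1 := by
      rw [← Matrix.transpose_transpose F, ← Matrix.transpose_mul, hFE, Matrix.transpose_one]
    have g1 : (E * T * Eᵀ + Q) * F = E * T := by
      rw [Matrix.add_mul, hQF, add_zero, Matrix.mul_assoc, hEF, Matrix.mul_one]
    have g2 : Fᵀ * (E * T * Eᵀ + Q) = T * Eᵀ := by
      rw [Matrix.mul_add, hFQ, add_zero, ← Matrix.mul_assoc, ← Matrix.mul_assoc, hFE,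
        Matrix.one_mul]
    have g3 : Fᵀ * (M * (E * T * Eᵀ + Q) + (E * T * Eᵀ + Q) * Mᵀ + C) * F = 0 := by
      rw [hMS, Matrix.mul_zero, Matrix.zero_mul]
    rw [Matrix.mul_add, Matrix.mul_add, Matrix.add_mul, Matrix.add_mul, hFCF,
      Matrix.mul_assoc Fᵀ (M * _), Matrix.mul_assoc M, g1, ← Matrix.mul_assoc Fᵀ _ Mᵀ, g2] at g3
    rw [Matrix.transpose_mul, Matrix.transpose_mul, Matrix.transpose_transpose]
    simpa only [Matrix.mul_assoc] using g3

end Induced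

/-! ### Witness covariances on at most four vertices. -/

section Witnesses

/-- T = BᵀDB with B unit upper triangular. For the rational witnesses below, this factorisation can
be checked entry by entry. -/
theorem Matrix.posDef_of_congr_diagonal {n : ℕ} {T B : Matrix (Fin n) (Fin n) ℝ} {d : Fin n → ℝ}
    (hd : ∀ i, 0 < d i) (hB : ∀ i j, j < i → B i j = 0) (hB' : ∀ i, B i i = 1)
    (h : ∀ i j, ∑ k, B k i * d k * B k j = T i j) : T.PosDef := by
  have hdet : B.det = 1 := by
    rw [Matrix.det_of_isUpperTriangular fun i j hij => hB i j hij]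
    simp [hB']
  have h' : Bᵀ * Matrix.diagonal d * B = T := by
    ext i j
    rw [← h, Matrix.mul_apply]
    simp [Matrix.mul_diagonal]
  rw [← h']
  have := (Matrix.PosDef.diagonal hd).conjTranspose_mul_mul_same (B := B)
    (Matrix.mulVec_injective_iff_isUnit.2
      ((Matrix.isUnit_iff_isUnit_det _).2 (by rw [hdet]; exact isUnit_one)))
  rwa [Matrix.conjTranspose_eq_transpose_of_trivial] at this

theorem lyapunov_one_iff {n : ℕ} {N T : Matrix (Fin n) (Fin n) ℝ} :
    N * T + T * Nᵀ + 1 = 0 ↔ ∀ x y,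
      ∑ k, N x k * T k y + ∑ k, T x k * N y k + (if x = y then 1 else 0) = 0 := by
  simp [← Matrix.ext_iff, Matrix.mul_apply, Matrix.one_apply]

variable {V : Type} [Fintype V] [DecidableEq V] {G H : LoopedDigraph V} {c : V → ℝ}

/-- An edge of `G` between vertices that are not adjacent in `H`. -/
theorem not_subset_of_not_linked (hc : ∀ k, 0 < c k)
    {a b : V}
    (nab : a ≠ b) (hab : G.Adj a b) (xab : ¬ H.Adj a b) (xba : ¬ H.Adj b a) :
    ¬ lyapunovModel G (Matrix.diagonal c) ⊆ lyapunovModel H (Matrix.diagonal c) := by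
  intro hsub
  have hf : Function.Injective (![a, b] : Fin 2 → V) := by
    intro x y hxy
    fin_cases x <;> fin_cases y <;> simp_all
  -- T solves the equation for the matrix with diagonal −1/2 and integer weights on the edges, as in
  -- all the witnesses below. For fixed T the equation is linear in N, and the zero pattern of H
  -- leaves fewer unknowns than the symmetric equation has entries: here two against three.
  have hT : Matrix.PosDef (!![1, 1; 1, 3] : Matrix (Fin 2) (Fin 2) ℝ) := by
    refine Matrix.posDef_of_congr_diagonal (B := !![1, 1; 0, 1])
      (d := ![1, 2]) ?_ ?_ ?_ ?_
    · intro x; fin_cases x <;> norm_num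
    · intro x y hxy; fin_cases x <;> fin_cases y <;> first | rfl | exact absurd hxy (by decide)
    · intro x; fin_cases x <;> rfl
    · intro x y
      fin_cases x <;> fin_cases y <;> norm_num [Fin.sum_univ_succ]
  have hN0 : IsSparseMatrix (G.comap (![a, b] : Fin 2 → V))
      !![-1/2, 0; 1, -1/2] := by
    intro x y hxy
    fin_cases x <;> fin_cases y <;>
      first
      | rfl
      | exact absurd (by first | assumption | exact G.loop _) hxy
  obtain ⟨N, hN, h⟩ := exists_sparse_of_lyapunovModel_subset hc hsub hf hT hN0 (by
    rw [lyapunov_one_iff]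
    intro x y
    fin_cases x <;> fin_cases y <;> norm_num [Fin.sum_univ_succ])
  rw [lyapunov_one_iff] at h
  have z01 : N 1 0 = 0 := hN 0 1 xab
  have z10 : N 0 1 = 0 := hN 1 0 xba
  have e00 := h 0 0
  have e01 := h 0 1
  have e11 := h 1 1
  simp [Fin.sum_univ_succ, z01, z10] at e00 e01 e11
  linarith

/-- A chain in `G` that is not a chain in the same direction in `H`. -/
theorem not_subset_of_chain (hc : ∀ k, 0 < c k)
    {i j k : V}
    (nij : i ≠ j) (nik : i ≠ k) (njk : j ≠ k) (hij : G.Adj i j) (hjk : G.Adj j k)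
    (xij : ¬ H.Adj i j) (xik : ¬ H.Adj i k) (xki : ¬ H.Adj k i) (hor : ¬ H.Adj k j ∨ ¬ H.Adj j k) :
    ¬ lyapunovModel G (Matrix.diagonal c) ⊆ lyapunovModel H (Matrix.diagonal c) := by
  intro hsub
  have hf : Function.Injective (![i, j, k] : Fin 3 → V) := by
    intro x y hxy
    fin_cases x <;> fin_cases y <;> simp_all
  have hT : Matrix.PosDef (!![1, 1, 1; 1, 3, 4; 1, 4, 9] : Matrix (Fin 3) (Fin 3) ℝ) := by
    refine Matrix.posDef_of_congr_diagonal (B := !![1, 1, 1; 0, 1, 3/2; 0, 0, 1])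
      (d := ![1, 2, 7/2]) ?_ ?_ ?_ ?_
    · intro x; fin_cases x <;> norm_num
    · intro x y hxy; fin_cases x <;> fin_cases y <;> first | rfl | exact absurd hxy (by decide)
    · intro x; fin_cases x <;> rfl
    · intro x y
      fin_cases x <;> fin_cases y <;> norm_num [Fin.sum_univ_succ]
  have hN0 : IsSparseMatrix (G.comap (![i, j, k] : Fin 3 → V))
      !![-1/2, 0, 0; 1, -1/2, 0; 0, 1, -1/2] := by
    intro x y hxy
    fin_cases x <;> fin_cases y <;>
      first
      | rfl
      | exact absurd (by first | assumption | exact G.loop _) hxy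
  obtain ⟨N, hN, h⟩ := exists_sparse_of_lyapunovModel_subset hc hsub hf hT hN0 (by
    rw [lyapunov_one_iff]
    intro x y
    fin_cases x <;> fin_cases y <;> norm_num [Fin.sum_univ_succ])
  rw [lyapunov_one_iff] at h
  have z01 : N 1 0 = 0 := hN 0 1 xij
  have z02 : N 2 0 = 0 := hN 0 2 xik
  have z20 : N 0 2 = 0 := hN 2 0 xki
  have e00 := h 0 0
  have e01 := h 0 1
  have e02 := h 0 2
  have e11 := h 1 1
  have e12 := h 1 2
  have e22 := h 2 2
  simp [Fin.sum_univ_succ, z01, z02, z20] at e00 e01 e02 e11 e12 e22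
  -- Five unknowns and six equations, whichever direction H allows between j and k.
  rcases hor with hx | hx
  · have z : N 1 2 = 0 := hN 2 1 hx
    linarith
  · have z : N 2 1 = 0 := hN 1 2 hx
    linarith

/-- A collider in `G` that is not a collider in `H`. -/
theorem not_subset_of_collider (hc : ∀ k, 0 < c k)
    {i k j : V}
    (nik : i ≠ k) (nij : i ≠ j) (nkj : k ≠ j) (hij : G.Adj i j) (hkj : G.Adj k j)
    (xik : ¬ H.Adj i k) (xij : ¬ H.Adj i j) (xki : ¬ H.Adj k i) (hor : ¬ H.Adj j k ∨ ¬ H.Adj k j) :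
    ¬ lyapunovModel G (Matrix.diagonal c) ⊆ lyapunovModel H (Matrix.diagonal c) := by
  intro hsub
  have hf : Function.Injective (![i, k, j] : Fin 3 → V) := by
    intro x y hxy
    fin_cases x <;> fin_cases y <;> simp_all
  have hT : Matrix.PosDef (!![1, 0, 1; 0, 1, 1; 1, 1, 5] : Matrix (Fin 3) (Fin 3) ℝ) := by
    refine Matrix.posDef_of_congr_diagonal (B := !![1, 0, 1; 0, 1, 1; 0, 0, 1])
      (d := ![1, 1, 3]) ?_ ?_ ?_ ?_
    · intro x; fin_cases x <;> norm_num
    · intro x y hxy; fin_cases x <;> fin_cases y <;> first | rfl | exact absurd hxy (by decide)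
    · intro x; fin_cases x <;> rfl
    · intro x y
      fin_cases x <;> fin_cases y <;> norm_num [Fin.sum_univ_succ]
  have hN0 : IsSparseMatrix (G.comap (![i, k, j] : Fin 3 → V))
      !![-1/2, 0, 0; 0, -1/2, 0; 1, 1, -1/2] := by
    intro x y hxy
    fin_cases x <;> fin_cases y <;>
      first
      | rfl
      | exact absurd (by first | assumption | exact G.loop _) hxy
  obtain ⟨N, hN, h⟩ := exists_sparse_of_lyapunovModel_subset hc hsub hf hT hN0 (by
    rw [lyapunov_one_iff]
    intro x y
    fin_cases x <;> fin_cases y <;> norm_num [Fin.sum_univ_succ])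
  rw [lyapunov_one_iff] at h
  have z01 : N 1 0 = 0 := hN 0 1 xik
  have z02 : N 2 0 = 0 := hN 0 2 xij
  have z10 : N 0 1 = 0 := hN 1 0 xki
  have e00 := h 0 0
  have e01 := h 0 1
  have e02 := h 0 2
  have e11 := h 1 1
  have e12 := h 1 2
  have e22 := h 2 2
  simp [Fin.sum_univ_succ, z01, z02, z10] at e00 e01 e02 e11 e12 e22
  rcases hor with hx | hx
  · have z : N 1 2 = 0 := hN 2 1 hx
    linarith
  · have z : N 2 1 = 0 := hN 1 2 hx
    linarith

/-- An edge with a grandparent that is not a parent. -/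
theorem not_subset_of_grandparent (hc : ∀ k, 0 < c k)
    {p a i j : V}
    (npa : p ≠ a) (npi : p ≠ i) (npj : p ≠ j) (nai : a ≠ i) (naj : a ≠ j) (nij : i ≠ j)
    (hpa : G.Adj p a) (hai : G.Adj a i) (haj : G.Adj a j) (hij : G.Adj i j) (xpi : ¬ H.Adj p i)
    (xpj : ¬ H.Adj p j) (xap : ¬ H.Adj a p) (xip : ¬ H.Adj i p) (xia : ¬ H.Adj i a)
    (xij : ¬ H.Adj i j) (xjp : ¬ H.Adj j p) (xja : ¬ H.Adj j a) :
    ¬ lyapunovModel G (Matrix.diagonal c) ⊆ lyapunovModel H (Matrix.diagonal c) := by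
  intro hsub
  have hf : Function.Injective (![p, a, i, j] : Fin 4 → V) := by
    intro x y hxy
    fin_cases x <;> fin_cases y <;> simp_all
  have hT : Matrix.PosDef (!![1, 1, 1, 1; 1, 3, 4, 3; 1, 4, 9, 2; 1, 3, 2, 9] : Matrix (Fin 4) (Fin 4) ℝ) := by
    refine Matrix.posDef_of_congr_diagonal (B := !![1, 1, 1, 1; 0, 1, 3/2, 1; 0, 0, 1, -4/7; 0, 0, 0, 1])
      (d := ![1, 2, 7/2, 34/7]) ?_ ?_ ?_ ?_
    · intro x; fin_cases x <;> norm_num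
    · intro x y hxy; fin_cases x <;> fin_cases y <;> first | rfl | exact absurd hxy (by decide)
    · intro x; fin_cases x <;> rfl
    · intro x y
      fin_cases x <;> fin_cases y <;> norm_num [Fin.sum_univ_succ]
  have hN0 : IsSparseMatrix (G.comap (![p, a, i, j] : Fin 4 → V))
      !![-1/2, 0, 0, 0; 1, -1/2, 0, 0; 0, 1, -1/2, 0; 0, 2, -1, -1/2] := by
    intro x y hxy
    fin_cases x <;> fin_cases y <;>
      first
      | rfl
      | exact absurd (by first | assumption | exact G.loop _) hxy
  obtain ⟨N, hN, h⟩ := exists_sparse_of_lyapunovModel_subset hc hsub hf hT hN0 (by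
    rw [lyapunov_one_iff]
    intro x y
    fin_cases x <;> fin_cases y <;> norm_num [Fin.sum_univ_succ])
  rw [lyapunov_one_iff] at h
  have z02 : N 2 0 = 0 := hN 0 2 xpi
  have z03 : N 3 0 = 0 := hN 0 3 xpj
  have z10 : N 0 1 = 0 := hN 1 0 xap
  have z20 : N 0 2 = 0 := hN 2 0 xip
  have z21 : N 1 2 = 0 := hN 2 1 xia
  have z23 : N 3 2 = 0 := hN 2 3 xij
  have z30 : N 0 3 = 0 := hN 3 0 xjp
  have z31 : N 1 3 = 0 := hN 3 1 xja
  have e00 := h 0 0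
  have e01 := h 0 1
  have e02 := h 0 2
  have e03 := h 0 3
  have e11 := h 1 1
  have e12 := h 1 2
  have e13 := h 1 3
  have e22 := h 2 2
  have e23 := h 2 3
  have e33 := h 3 3
  -- H can contain only p → a, a → i, a → j and j → i, so eight unknowns face ten equations.
  simp [Fin.sum_univ_succ, z02, z03, z10, z20, z21, z23, z30, z31] at e00 e01 e02 e03 e11 e12 e13 e22 e23 e33
  linarith

/-- An edge with a grandchild that is not a child. -/
theorem not_subset_of_grandchild (hc : ∀ k, 0 < c k)
    {i j a b : V}
    (nij : i ≠ j) (nia : i ≠ a) (nib : i ≠ b) (nja : j ≠ a) (njb : j ≠ b) (nab : a ≠ b)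
    (hij : G.Adj i j) (hia : G.Adj i a) (hja : G.Adj j a) (hab : G.Adj a b) (xij : ¬ H.Adj i j)
    (xib : ¬ H.Adj i b) (xjb : ¬ H.Adj j b) (xai : ¬ H.Adj a i) (xaj : ¬ H.Adj a j)
    (xbi : ¬ H.Adj b i) (xbj : ¬ H.Adj b j) (xba : ¬ H.Adj b a) :
    ¬ lyapunovModel G (Matrix.diagonal c) ⊆ lyapunovModel H (Matrix.diagonal c) := by
  intro hsub
  have hf : Function.Injective (![i, j, a, b] : Fin 4 → V) := by
    intro x y hxy
    fin_cases x <;> fin_cases y <;> simp_all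
  have hT : Matrix.PosDef (!![1, 1, 0, 0; 1, 3, -2, -2; 0, -2, 5, 7; 0, -2, 7, 15] : Matrix (Fin 4) (Fin 4) ℝ) := by
    refine Matrix.posDef_of_congr_diagonal (B := !![1, 1, 0, 0; 0, 1, -1, -1; 0, 0, 1, 5/3; 0, 0, 0, 1])
      (d := ![1, 2, 3, 14/3]) ?_ ?_ ?_ ?_
    · intro x; fin_cases x <;> norm_num
    · intro x y hxy; fin_cases x <;> fin_cases y <;> first | rfl | exact absurd hxy (by decide)
    · intro x; fin_cases x <;> rfl
    · intro x y
      fin_cases x <;> fin_cases y <;> norm_num [Fin.sum_univ_succ]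
  have hN0 : IsSparseMatrix (G.comap (![i, j, a, b] : Fin 4 → V))
      !![-1/2, 0, 0, 0; 1, -1/2, 0, 0; 1, -1, -1/2, 0; 0, 0, 1, -1/2] := by
    intro x y hxy
    fin_cases x <;> fin_cases y <;>
      first
      | rfl
      | exact absurd (by first | assumption | exact G.loop _) hxy
  obtain ⟨N, hN, h⟩ := exists_sparse_of_lyapunovModel_subset hc hsub hf hT hN0 (by
    rw [lyapunov_one_iff]
    intro x y
    fin_cases x <;> fin_cases y <;> norm_num [Fin.sum_univ_succ])
  rw [lyapunov_one_iff] at h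
  have z01 : N 1 0 = 0 := hN 0 1 xij
  have z03 : N 3 0 = 0 := hN 0 3 xib
  have z13 : N 3 1 = 0 := hN 1 3 xjb
  have z20 : N 0 2 = 0 := hN 2 0 xai
  have z21 : N 1 2 = 0 := hN 2 1 xaj
  have z30 : N 0 3 = 0 := hN 3 0 xbi
  have z31 : N 1 3 = 0 := hN 3 1 xbj
  have z32 : N 2 3 = 0 := hN 3 2 xba
  have e00 := h 0 0
  have e01 := h 0 1
  have e02 := h 0 2
  have e03 := h 0 3
  have e11 := h 1 1
  have e12 := h 1 2
  have e13 := h 1 3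
  have e22 := h 2 2
  have e23 := h 2 3
  have e33 := h 3 3
  simp [Fin.sum_univ_succ, z01, z03, z13, z20, z21, z30, z31, z32] at e00 e01 e02 e03 e11 e12 e13 e22 e23 e33
  linarith

/-- An edge with a sibling that is not adjacent to it. -/
theorem not_subset_of_sibling (hc : ∀ k, 0 < c k)
    {a i j b : V}
    (nai : a ≠ i) (naj : a ≠ j) (nab : a ≠ b) (nij : i ≠ j) (nib : i ≠ b) (njb : j ≠ b)
    (hai : G.Adj a i) (haj : G.Adj a j) (hij : G.Adj i j) (hab : G.Adj a b) (xia : ¬ H.Adj i a)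
    (xij : ¬ H.Adj i j) (xib : ¬ H.Adj i b) (xja : ¬ H.Adj j a) (xjb : ¬ H.Adj j b)
    (xba : ¬ H.Adj b a) (xbi : ¬ H.Adj b i) (xbj : ¬ H.Adj b j) :
    ¬ lyapunovModel G (Matrix.diagonal c) ⊆ lyapunovModel H (Matrix.diagonal c) := by
  intro hsub
  have hf : Function.Injective (![a, i, j, b] : Fin 4 → V) := by
    intro x y hxy
    fin_cases x <;> fin_cases y <;> simp_all
  have hT : Matrix.PosDef (!![1, 1, 0, 1; 1, 3, -2, 2; 0, -2, 5, -1; 1, 2, -1, 3] : Matrix (Fin 4) (Fin 4) ℝ) := by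
    refine Matrix.posDef_of_congr_diagonal (B := !![1, 1, 0, 1; 0, 1, -1, 1/2; 0, 0, 1, 0; 0, 0, 0, 1])
      (d := ![1, 2, 3, 3/2]) ?_ ?_ ?_ ?_
    · intro x; fin_cases x <;> norm_num
    · intro x y hxy; fin_cases x <;> fin_cases y <;> first | rfl | exact absurd hxy (by decide)
    · intro x; fin_cases x <;> rfl
    · intro x y
      fin_cases x <;> fin_cases y <;> norm_num [Fin.sum_univ_succ]
  have hN0 : IsSparseMatrix (G.comap (![a, i, j, b] : Fin 4 → V))
      !![-1/2, 0, 0, 0; 1, -1/2, 0, 0; 1, -1, -1/2, 0; 1, 0, 0, -1/2] := by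
    intro x y hxy
    fin_cases x <;> fin_cases y <;>
      first
      | rfl
      | exact absurd (by first | assumption | exact G.loop _) hxy
  obtain ⟨N, hN, h⟩ := exists_sparse_of_lyapunovModel_subset hc hsub hf hT hN0 (by
    rw [lyapunov_one_iff]
    intro x y
    fin_cases x <;> fin_cases y <;> norm_num [Fin.sum_univ_succ])
  rw [lyapunov_one_iff] at h
  have z10 : N 0 1 = 0 := hN 1 0 xia
  have z12 : N 2 1 = 0 := hN 1 2 xij
  have z13 : N 3 1 = 0 := hN 1 3 xib
  have z20 : N 0 2 = 0 := hN 2 0 xja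
  have z23 : N 3 2 = 0 := hN 2 3 xjb
  have z30 : N 0 3 = 0 := hN 3 0 xba
  have z31 : N 1 3 = 0 := hN 3 1 xbi
  have z32 : N 2 3 = 0 := hN 3 2 xbj
  have e00 := h 0 0
  have e01 := h 0 1
  have e02 := h 0 2
  have e03 := h 0 3
  have e11 := h 1 1
  have e12 := h 1 2
  have e13 := h 1 3
  have e22 := h 2 2
  have e23 := h 2 3
  have e33 := h 3 3
  simp [Fin.sum_univ_succ, z10, z12, z13, z20, z23, z30, z31, z32] at e00 e01 e02 e03 e11 e12 e13 e22 e23 e33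
  linarith

/-- An edge with a parent and a child that are not adjacent. -/
theorem not_subset_of_unshielded_middle (hc : ∀ k, 0 < c k)
    {a i j b : V}
    (nai : a ≠ i) (naj : a ≠ j) (nab : a ≠ b) (nij : i ≠ j) (nib : i ≠ b) (njb : j ≠ b)
    (hai : G.Adj a i) (haj : G.Adj a j) (hij : G.Adj i j) (hib : G.Adj i b) (hjb : G.Adj j b)
    (xab : ¬ H.Adj a b) (xia : ¬ H.Adj i a) (xij : ¬ H.Adj i j) (xja : ¬ H.Adj j a)
    (xba : ¬ H.Adj b a) (xbi : ¬ H.Adj b i) (xbj : ¬ H.Adj b j) :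
    ¬ lyapunovModel G (Matrix.diagonal c) ⊆ lyapunovModel H (Matrix.diagonal c) := by
  intro hsub
  have hf : Function.Injective (![a, i, j, b] : Fin 4 → V) := by
    intro x y hxy
    fin_cases x <;> fin_cases y <;> simp_all
  have hT : Matrix.PosDef (!![1, 1, 0, 1; 1, 3, -2, 2; 0, -2, 5, 2; 1, 2, 2, 9] : Matrix (Fin 4) (Fin 4) ℝ) := by
    refine Matrix.posDef_of_congr_diagonal (B := !![1, 1, 0, 1; 0, 1, -1, 1/2; 0, 0, 1, 1; 0, 0, 0, 1])
      (d := ![1, 2, 3, 9/2]) ?_ ?_ ?_ ?_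
    · intro x; fin_cases x <;> norm_num
    · intro x y hxy; fin_cases x <;> fin_cases y <;> first | rfl | exact absurd hxy (by decide)
    · intro x; fin_cases x <;> rfl
    · intro x y
      fin_cases x <;> fin_cases y <;> norm_num [Fin.sum_univ_succ]
  have hN0 : IsSparseMatrix (G.comap (![a, i, j, b] : Fin 4 → V))
      !![-1/2, 0, 0, 0; 1, -1/2, 0, 0; 1, -1, -1/2, 0; 0, 1, 1, -1/2] := by
    intro x y hxy
    fin_cases x <;> fin_cases y <;>
      first
      | rfl
      | exact absurd (by first | assumption | exact G.loop _) hxy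
  obtain ⟨N, hN, h⟩ := exists_sparse_of_lyapunovModel_subset hc hsub hf hT hN0 (by
    rw [lyapunov_one_iff]
    intro x y
    fin_cases x <;> fin_cases y <;> norm_num [Fin.sum_univ_succ])
  rw [lyapunov_one_iff] at h
  have z03 : N 3 0 = 0 := hN 0 3 xab
  have z10 : N 0 1 = 0 := hN 1 0 xia
  have z12 : N 2 1 = 0 := hN 1 2 xij
  have z20 : N 0 2 = 0 := hN 2 0 xja
  have z30 : N 0 3 = 0 := hN 3 0 xba
  have z31 : N 1 3 = 0 := hN 3 1 xbi
  have z32 : N 2 3 = 0 := hN 3 2 xbj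
  have e00 := h 0 0
  have e01 := h 0 1
  have e02 := h 0 2
  have e03 := h 0 3
  have e11 := h 1 1
  have e12 := h 1 2
  have e13 := h 1 3
  have e22 := h 2 2
  have e23 := h 2 3
  have e33 := h 3 3
  -- Nine unknowns and ten equations: H still has the other four edges of G, and j → i.
  simp [Fin.sum_univ_succ, z03, z10, z12, z20, z30, z31, z32] at e00 e01 e02 e03 e11 e12 e13 e22 e23 e33
  linarith

end Witnesses

/-! ### Necessity of the local criterion. -/

namespace LoopedDigraph

section Necessity

variable {V : Type} [Fintype V] [DecidableEq V] {G H : LoopedDigraph V} {c : V → ℝ}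

theorem linked_of_subset (hc : ∀ k, 0 < c k)
    (h : lyapunovModel G (Matrix.diagonal c) ⊆ lyapunovModel H (Matrix.diagonal c)) {a b : V}
    (hl : G.Linked a b) : H.Linked a b := by
  by_contra hn
  have hab : a ≠ b := by
    rintro rfl
    exact hn (Or.inl (H.loop _))
  have h1 : ¬ H.Adj a b := fun e => hn (Or.inl e)
  have h2 : ¬ H.Adj b a := fun e => hn (Or.inr e)
  rcases hl with hl | hl
  · exact not_subset_of_not_linked hc hab hl h1 h2 h
  · exact not_subset_of_not_linked hc hab.symm hl h2 h1 h

/-- In G, the edge i → j and the edge between j and k form a chain or a collider. An edge of G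
between i and k does no harm, as the witnesses give it weight 0. -/
theorem twin_of_subset (hc : ∀ k, 0 < c k) (hH : H.IsAcyclic)
    (h : lyapunovModel G (Matrix.diagonal c) ⊆ lyapunovModel H (Matrix.diagonal c)) {i j k : V}
    (hij : i ≠ j) (h1 : G.Adj i j) (h2 : H.Adj j i) (hl : G.Linked j k) : H.Linked i k := by
  by_contra hn
  have hik : i ≠ k := by
    rintro rfl
    exact hn (Or.inl (H.loop _))
  have hjk : j ≠ k := by
    rintro rfl
    exact hn (Or.inr h2)
  have x1 : ¬ H.Adj i k := fun e => hn (Or.inl e)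
  have x2 : ¬ H.Adj k i := fun e => hn (Or.inr e)
  have x3 : ¬ H.Adj i j := fun e => hij (hH.antisymm e h2)
  have x4 : ¬ H.Adj j k ∨ ¬ H.Adj k j := by
    by_contra! e
    exact hjk (hH.antisymm e.1 e.2)
  rcases hl with hl | hl
  · exact not_subset_of_chain hc hij hik hjk h1 hl x3 x1 x2 x4.symm h
  · exact not_subset_of_collider hc hik hij hjk.symm h1 hl x1 x3 x2 x4 h

/-- A failure of `Local i` extends to j because i and j have the same neighbours. On the four
vertices involved, all edges but i → j are forced to keep their direction in H, and one of the
four-vertex witnesses applies. -/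
theorem local_of_lyapunovModel_eq (hc : ∀ k, 0 < c k) (hG : G.IsAcyclic) (hH : H.IsAcyclic)
    (h : lyapunovModel G (Matrix.diagonal c) ⊆ lyapunovModel H (Matrix.diagonal c))
    (hl : ∀ a b, G.Linked a b ↔ H.Linked a b)
    (tw : ∀ i j, i ≠ j → G.Adj i j → H.Adj j i → ∀ k, G.Linked i k ↔ G.Linked j k) {i j : V}
    (hne : i ≠ j) (hij : G.Adj i j) (hji : H.Adj j i) : G.Local i ∧ G.Local j := by
  have ne_of : ∀ {x y z}, G.Linked x z → ¬ G.Linked y z → x ≠ y := by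
    rintro x y z h1 h2 rfl
    exact h2 h1
  -- An edge whose ends disagree about being linked to some z cannot be reversed in H, as reversal
  -- would require equal neighbourhoods.
  have fix1 : ∀ {x y z}, G.Adj x y → G.Linked x z → ¬ G.Linked y z →
      H.Adj x y ∧ ¬ H.Adj y x := by
    intro x y z hxy h1 h2
    have h3 : ¬ H.Adj y x := fun e => h2 ((tw x y (ne_of h1 h2) hxy e z).1 h1)
    exact ⟨((hl x y).1 (Or.inl hxy)).resolve_right h3, h3⟩
  have fix2 : ∀ {x y z}, G.Adj x y → G.Linked y z → ¬ G.Linked x z →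
      H.Adj x y ∧ ¬ H.Adj y x := by
    intro x y z hxy h1 h2
    have h3 : ¬ H.Adj y x := fun e => h2 ((tw x y (ne_of h1 h2).symm hxy e z).2 h1)
    exact ⟨((hl x y).1 (Or.inl hxy)).resolve_right h3, h3⟩
  have nl : ∀ {x y}, ¬ G.Linked x y → ¬ H.Adj x y ∧ ¬ H.Adj y x := fun hxy =>
    ⟨fun e => hxy ((hl _ _).2 (Or.inl e)), fun e => hxy ((hl _ _).2 (Or.inr e))⟩
  have loop : ∀ x, G.Linked x x := fun x => Or.inl (G.loop x)
  have t : ∀ k, G.Linked i k ↔ G.Linked j k := tw i j hne hij hji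
  have t' : ∀ k, G.Linked k i ↔ G.Linked k j := fun k =>
    ⟨fun e => ((t k).1 e.symm).symm, fun e => ((t k).2 e.symm).symm⟩
  have xij : ¬ H.Adj i j := fun e => hne (hH.antisymm e hji)
  -- Excludes a vertex a with i → a → j in the unshielded configurations: both edges would keep
  -- their direction and close a cycle with j → i in H.
  have cyc : ∀ {a}, H.Adj i a → H.Adj a j → a ≠ i → False := fun h1 h2 h3 =>
    h3 (hH.eq_of_triangle hji h1 h2).2.symm
  have loc1 : ∀ a b, G.Adj b a → G.Adj a i → G.Linked b i := by
    intro a b hba hai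
    by_contra hn
    have hnj : ¬ G.Linked b j := fun e => hn ((t' b).2 e)
    have nai : a ≠ i := ne_of (Or.inr hba) (fun e => hn e.symm)
    have naj : a ≠ j := by rintro rfl; exact hne (hG.antisymm hij hai)
    have haj : G.Adj a j := by
      rcases (t' a).1 (Or.inl hai) with e | e
      · exact e
      · exact absurd (hG.eq_of_triangle hij e hai).1 hne
    have f1 := fix1 hai (Or.inr hba) (fun e => hn e.symm)
    have f2 := fix1 haj (Or.inr hba) (fun e => hnj e.symm)
    have f3 := fix2 hba (Or.inl hai) hn
    exact not_subset_of_grandparent hc (ne_of (Or.inl hai) hn).symm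
      (ne_of (loop i) hn).symm (ne_of (loop j) hnj).symm nai naj hne hba hai haj hij
      (nl hn).1 (nl hnj).1 f3.2 (nl hn).2 f1.2 xij (nl hnj).2 f2.2 h
  have loc2 : ∀ a b, G.Adj i a → G.Adj a b → G.Linked b i := by
    intro a b hia hab
    by_contra hn
    have hnj : ¬ G.Linked b j := fun e => hn ((t' b).2 e)
    have nia : a ≠ i := ne_of (Or.inl hab) (fun e => hn e.symm)
    have nja : a ≠ j := ne_of (Or.inl hab) (fun e => hnj e.symm)
    have f1 := fix2 hia (Or.inl hab) (fun e => hn e.symm)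
    have hja : G.Adj j a := by
      rcases (t a).1 (Or.inl hia) with e | e
      · exact e
      · exact (cyc f1.1 (fix1 e (Or.inl hab) (fun e => hnj e.symm)).1 nia).elim
    have f2 := fix2 hja (Or.inl hab) (fun e => hnj e.symm)
    have f3 := fix1 hab (Or.inr hia) hn
    exact not_subset_of_grandchild hc hne nia.symm (ne_of (loop i) hn) nja.symm
      (ne_of (loop j) hnj) (ne_of (Or.inr hia) hn) hij hia hja hab xij (nl hn).2 (nl hnj).2
      f1.2 f2.2 (nl hn).1 (nl hnj).1 f3.2 h
  have loc3 : ∀ a b, G.Adj a i → G.Adj a b → G.Linked b i := by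
    intro a b hai hab
    by_contra hn
    have hnj : ¬ G.Linked b j := fun e => hn ((t' b).2 e)
    have nai : a ≠ i := ne_of (Or.inl hab) (fun e => hn e.symm)
    have naj : a ≠ j := by rintro rfl; exact hne (hG.antisymm hij hai)
    have haj : G.Adj a j := by
      rcases (t' a).1 (Or.inl hai) with e | e
      · exact e
      · exact absurd (hG.eq_of_triangle hij e hai).1 hne
    have f1 := fix1 hai (Or.inl hab) (fun e => hn e.symm)
    have f2 := fix1 haj (Or.inl hab) (fun e => hnj e.symm)
    have f3 := fix1 hab (Or.inl hai) hn
    exact not_subset_of_sibling hc nai naj (ne_of (Or.inl hai) hn) hne (ne_of (loop i) hn)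
      (ne_of (loop j) hnj) hai haj hij hab f1.2 xij (nl hn).2 f2.2 (nl hnj).2 f3.2 (nl hn).1
      (nl hnj).1 h
  have loc4 : ∀ a b, G.Adj a i → G.Adj i b → G.Linked a b := by
    intro a b hai hib
    by_contra hn
    have hn' : ¬ G.Linked b a := fun e => hn e.symm
    have naj : a ≠ j := by rintro rfl; exact hne (hG.antisymm hij hai)
    have haj : G.Adj a j := by
      rcases (t' a).1 (Or.inl hai) with e | e
      · exact e
      · exact absurd (hG.eq_of_triangle hij e hai).1 hne
    have nib : i ≠ b := ne_of (Or.inr hai) hn'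
    have njb : j ≠ b := ne_of (Or.inr haj) hn'
    have hlj : G.Linked j b := (t b).1 (Or.inl hib)
    have f1 := fix2 hai (Or.inl hib) hn
    have f2 := fix2 haj hlj hn
    have f3 := fix1 hib (Or.inr hai) hn'
    have hjb : G.Adj j b := by
      rcases hlj with e | e
      · exact e
      · exact (cyc f3.1 (fix2 e (Or.inr haj) hn').1 nib.symm).elim
    have f4 := fix1 hjb (Or.inr haj) hn'
    exact not_subset_of_unshielded_middle hc (ne_of (Or.inl hib) hn).symm naj
      (ne_of (loop a) hn') hne nib njb hai haj hij hib hjb (nl hn).1 f1.2 xij f2.2 (nl hn).2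
      f3.2 f4.2 h
  -- `Local j` follows from `Local i` by equality of neighbourhoods, except where i → a → j, which
  -- `cyc` handles when needed.
  refine ⟨fun a b => ⟨loc1 a b, loc2 a b, loc3 a b, loc4 a b⟩,
    fun a b => ⟨fun hba haj => ?_, fun hja hab => ?_, fun haj hab => ?_, fun haj hjb => ?_⟩⟩
  · by_contra hn
    have hni : ¬ G.Linked i b := fun e => hn ((t' b).1 e.symm)
    rcases (t' a).2 (Or.inl haj) with e | e
    · exact hni (loc1 a b hba e).symm
    · exact cyc (fix2 e (Or.inr hba) hni).1 (fix1 haj (Or.inr hba) (fun e => hn e.symm)).1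
        (ne_of (Or.inr hba) hni)
  · rcases (t a).2 (Or.inl hja) with e | e
    · exact (t' b).1 (loc2 a b e hab)
    · exact absurd (hG.eq_of_triangle hij hja e).1 hne
  · rcases (t' a).2 (Or.inl haj) with e | e
    · exact (t' b).1 (loc3 a b e hab)
    · exact (t' b).1 (loc2 a b e hab)
  · by_contra hn
    have hib : G.Adj i b := by
      rcases (t b).2 (Or.inl hjb) with e | e
      · exact e
      · exact absurd (hG.eq_of_triangle hij hjb e).1 hne
    rcases (t' a).2 (Or.inl haj) with e | e
    · exact hn (loc4 a b e hib)
    · exact cyc (fix1 e (Or.inl hib) hn).1 (fix2 haj (Or.inl hjb) hn).1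
        (ne_of (Or.inl hib) hn).symm

/-- Acyclic Lyapunov models are equivalent if and only if the graphs are locally equivalent. -/
theorem modelEquivalent_iff (hc : ∀ k, 0 < c k) (hG : G.IsAcyclic) (hH : H.IsAcyclic) :
    ModelEquivalent (Matrix.diagonal c) G H ↔ LocallyEquivalent G H := by
  refine ⟨fun h => ?_, fun h => h.lyapunovModel_eq hc hG hH⟩
  have h1 : lyapunovModel G (Matrix.diagonal c) ⊆ lyapunovModel H (Matrix.diagonal c) :=
    Eq.subset h
  have h2 : lyapunovModel H (Matrix.diagonal c) ⊆ lyapunovModel G (Matrix.diagonal c) :=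
    Eq.subset h.symm
  have hl : ∀ a b, G.Linked a b ↔ H.Linked a b := fun a b =>
    ⟨linked_of_subset hc h1, linked_of_subset hc h2⟩
  have tw : ∀ i j, i ≠ j → G.Adj i j → H.Adj j i → ∀ k, G.Linked i k ↔ G.Linked j k :=
    fun i j hij e1 e2 k => ⟨fun e => twin_of_subset hc hG h2 hij.symm e2 e1 ((hl i k).1 e),
      fun e => (hl i k).2 (twin_of_subset hc hH h1 hij e1 e2 e)⟩
  exact ⟨hl, tw, fun i j hij e1 e2 => local_of_lyapunovModel_eq hc hG hH h1 hl tw hij e1 e2⟩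

/-- A DAG is structurally identifiable among the DAGs if and only if it has no reversible edge. -/
theorem structurallyIdentifiableWithin_iff (hc : ∀ k, 0 < c k) (hG : G.IsAcyclic) :
    StructurallyIdentifiableWithin (Matrix.diagonal c) {H : LoopedDigraph V | H.IsAcyclic} G ↔
      ∀ i j, ¬ G.Reversible i j := by
  constructor
  · rintro ⟨-, H, -, hH⟩ i j hr
    have h1 : G = H := hH G ⟨hG, rfl⟩
    have h2 : LoopedDigraph.relabel (Equiv.swap i j) G = H :=
      hH _ ⟨hG.relabel _, (lyapunovModel_swap hc hG hr).symm⟩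
    have h3 : G.Adj j i := by
      rw [← hr.swap_adj, h2, ← h1]
      exact hr.adj
    exact hr.ne (hG.antisymm hr.adj h3)
  · intro hr
    refine ⟨hG, G, ⟨hG, rfl⟩, ?_⟩
    rintro H ⟨hH, hGH⟩
    exact (((modelEquivalent_iff hc hG hH).1 hGH).eq_of_forall_not_reversible hG hH hr).symm

end Necessity

end LoopedDigraph

/-! ### Structured stack programs and their compilation. -/

namespace StackProgram

variable {K : Type} {Γ : K → Type} {σ : Type}

/-- Structured programs on finitely many stacks with contents in `Γ` and a register in `σ`. -/
inductive Cmd (Γ : K → Type) (σ : Type) : Type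
  /-- push a symbol that depends on the register -/
  | push (k : K) (f : σ → Γ k)
  /-- pop a symbol, if there is one, and update the register -/
  | pop (k : K) (f : σ → Option (Γ k) → σ)
  /-- update the register -/
  | load (f : σ → σ)
  /-- sequential composition -/
  | seq (a b : Cmd Γ σ)
  /-- conditional -/
  | ite (t : σ → Bool) (a b : Cmd Γ σ)
  /-- pop a symbol and update the register; if the register passes the test, then execute the
  body and start again, else stop -/
  | loop (k : K) (f : σ → Option (Γ k) → σ) (t : σ → Bool) (a : Cmd Γ σ)

namespace Cmd

/-- The labels of the compiled program. -/
def Lab : Cmd Γ σ → Type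
  | push _ _ => Unit
  | pop _ _ => Unit
  | load _ => Unit
  | seq a b => a.Lab ⊕ b.Lab
  | ite _ a b => Option (a.Lab ⊕ b.Lab)
  | loop _ _ _ a => Option a.Lab

instance labFintype : ∀ c : Cmd Γ σ, Fintype c.Lab
  | push _ _ => inferInstanceAs (Fintype Unit)
  | pop _ _ => inferInstanceAs (Fintype Unit)
  | load _ => inferInstanceAs (Fintype Unit)
  | seq a b => @instFintypeSum _ _ a.labFintype b.labFintype
  | ite _ a b => @instFintypeOption _ (@instFintypeSum _ _ a.labFintype b.labFintype)
  | loop _ _ _ a => @instFintypeOption _ a.labFintype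

/-- The label at which a program starts. -/
def entry : ∀ c : Cmd Γ σ, c.Lab
  | push _ _ => ()
  | pop _ _ => ()
  | load _ => ()
  | seq a _ => Sum.inl a.entry
  | ite _ _ _ => none
  | loop _ _ _ _ => none

/-- The statements of the compiled program: `emb` embeds its labels into those of the whole
machine, and `exit` is the label at which the machine continues afterwards. -/
def code : ∀ (c : Cmd Γ σ) {Λ : Type}, (c.Lab → Λ) → Λ → c.Lab → Turing.TM2.Stmt Γ Λ σ
  | push k f, _, _, exit, _ => .push k f (.goto fun _ => exit)
  | pop k f, _, _, exit, _ => .pop k f (.goto fun _ => exit)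
  | load f, _, _, exit, _ => .load f (.goto fun _ => exit)
  | seq a b, _, emb, _, Sum.inl l =>
      a.code (fun x => emb (Sum.inl x)) (emb (Sum.inr b.entry)) l
  | seq _ b, _, emb, exit, Sum.inr l => b.code (fun x => emb (Sum.inr x)) exit l
  | ite t a b, _, emb, _, none =>
      .branch t (.goto fun _ => emb (some (Sum.inl a.entry)))
        (.goto fun _ => emb (some (Sum.inr b.entry)))
  | ite _ a _, _, emb, exit, some (Sum.inl l) =>
      a.code (fun x => emb (some (Sum.inl x))) exit l
  | ite _ _ b, _, emb, exit, some (Sum.inr l) =>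
      b.code (fun x => emb (some (Sum.inr x))) exit l
  | loop k f t a, _, emb, exit, none =>
      .pop k f (.branch t (.goto fun _ => emb (some a.entry)) (.goto fun _ => exit))
  | loop _ _ _ a, _, emb, _, some l => a.code (fun x => emb (some x)) (emb none) l

end Cmd

variable [DecidableEq K]

/-- `Runs c s S s' S' n`: started with the register `s` and the stacks `S`, the program `c` stops
after `n` steps with the register `s'` and the stacks `S'`. -/
inductive Runs : Cmd Γ σ → σ → (∀ k, List (Γ k)) → σ → (∀ k, List (Γ k)) → ℕ → Prop
  | push (k f s S) : Runs (.push k f) s S s (Function.update S k (f s :: S k)) 1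
  | pop (k f s S) : Runs (.pop k f) s S (f s (S k).head?) (Function.update S k (S k).tail) 1
  | load (f s S) : Runs (.load f) s S (f s) S 1
  | seq {a b s S s₁ S₁ s₂ S₂ n₁ n₂} : Runs a s S s₁ S₁ n₁ → Runs b s₁ S₁ s₂ S₂ n₂ →
      Runs (.seq a b) s S s₂ S₂ (n₁ + n₂)
  | ite_true {t a b s S s₁ S₁ n} : t s = true → Runs a s S s₁ S₁ n →
      Runs (.ite t a b) s S s₁ S₁ (1 + n)
  | ite_false {t a b s S s₁ S₁ n} : t s = false → Runs b s S s₁ S₁ n →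
      Runs (.ite t a b) s S s₁ S₁ (1 + n)
  | loop_exit {k f t a s S} : t (f s (S k).head?) = false →
      Runs (.loop k f t a) s S (f s (S k).head?) (Function.update S k (S k).tail) 1
  | loop_step {k f t a s S s₁ S₁ n₁ s₂ S₂ n₂} : t (f s (S k).head?) = true →
      Runs a (f s (S k).head?) (Function.update S k (S k).tail) s₁ S₁ n₁ →
      Runs (.loop k f t a) s₁ S₁ s₂ S₂ n₂ →
      Runs (.loop k f t a) s S s₂ S₂ (1 + n₁ + n₂)

/-- Correctness of the compiler with exact timing. The embedding of labels and the exit label are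
arbitrary, so that the induction applies to subprograms in place inside a larger machine. -/
theorem Runs.iterate_step {c : Cmd Γ σ} {s S s' S' n} (h : Runs c s S s' S' n) {Λ : Type}
    (m : Λ → Turing.TM2.Stmt Γ Λ σ) (emb : c.Lab → Λ) (exit : Λ)
    (hm : ∀ l, m (emb l) = c.code emb exit l) :
    (flip bind (Turing.TM2.step m))^[n] (some ⟨some (emb c.entry), s, S⟩) =
      some ⟨some exit, s', S'⟩ := by
  induction h generalizing exit with
  | push | pop | load =>
    simp [flip, Turing.TM2.step, hm, Cmd.code, Turing.TM2.stepAux]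
  | @seq a b _ _ _ _ _ _ n₁ n₂ _ _ ih₁ ih₂ =>
    rw [Nat.add_comm, Function.iterate_add_apply]
    have h1 := ih₁ (fun x => emb (Sum.inl x)) (emb (Sum.inr b.entry)) fun l => hm _
    have h2 := ih₂ (fun x => emb (Sum.inr x)) exit fun l => hm _
    exact (congrArg _ h1).trans h2
  | @ite_true t a b _ _ _ _ n ht _ ih =>
    rw [Nat.add_comm, Function.iterate_add_apply]
    have h1 := ih (fun x => emb (some (Sum.inl x))) exit fun l => hm _
    rw [← h1]
    congr 1
    have h0 := hm none
    rw [Cmd.code] at h0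
    simp [flip, Turing.TM2.step, h0, Cmd.entry, Turing.TM2.stepAux, ht]
  | @ite_false t a b _ _ _ _ n ht _ ih =>
    rw [Nat.add_comm, Function.iterate_add_apply]
    have h1 := ih (fun x => emb (some (Sum.inr x))) exit fun l => hm _
    rw [← h1]
    congr 1
    have h0 := hm none
    rw [Cmd.code] at h0
    simp [flip, Turing.TM2.step, h0, Cmd.entry, Turing.TM2.stepAux, ht]
  | loop_exit ht =>
    have h0 := hm none
    rw [Cmd.code] at h0
    simp [flip, Turing.TM2.step, h0, Cmd.entry, Turing.TM2.stepAux, ht]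
  | @loop_step k f t a _ _ _ _ n₁ _ _ n₂ ht _ _ ih₁ ih₂ =>
    rw [Nat.add_comm, Function.iterate_add_apply, Nat.add_comm, Function.iterate_add_apply]
    have h1 := ih₁ (fun x => emb (some x)) (emb none) fun l => hm _
    refine Eq.trans ?_ (ih₂ emb exit hm)
    congr 1
    rw [show (emb (Cmd.loop k f t a).entry) = emb none from rfl, ← h1]
    congr 1
    have h0 := hm none
    rw [Cmd.code] at h0
    simp [flip, Turing.TM2.step, h0, Turing.TM2.stepAux, ht]

/-- The Turing machine that executes a program and halts. -/
def machine [Fintype K] [∀ k, Fintype (Γ k)] [Fintype σ] (c : Cmd Γ σ) (s₀ : σ) (k₀ k₁ : K) :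
    Turing.FinTM2 where
  K := K
  k₀ := k₀
  k₁ := k₁
  Γ := Γ
  Λ := Option c.Lab
  main := some c.entry
  σ := σ
  initialState := s₀
  m
    | none => .halt
    | some l => c.code some none l

theorem decidableInPolyTime_of_runs [Fintype K] [∀ k, Fintype (Γ k)] [Fintype σ] {α Γ₀ : Type}
    {enc : α → List Γ₀} {P : α → Prop} (c : Cmd Γ σ) (s₀ : σ) {k₀ k₁ : K} (e₀ : Γ k₀ ≃ Γ₀)
    (e₁ : Γ k₁ ≃ Bool) (p : Polynomial ℕ) (f : α → Bool) (hf : ∀ a, f a = true ↔ P a)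
    (h : ∀ a, ∃ n ≤ p.eval (enc a).length,
      Runs c s₀ (Function.update (fun _ => []) k₀ ((enc a).map e₀.symm)) s₀
        (Function.update (fun _ => []) k₁ [e₁.symm (f a)]) n) :
    DecidableInPolyTime enc P := by
  choose n hn hr using h
  have hfin : ∀ k : K, Finite (Γ k) := fun k => inferInstance
  -- One extra step executes the halt statement at the exit label.
  refine ⟨f, hf, ⟨⟨machine c s₀ k₀ k₁, e₀, e₁⟩, p + 1, fun a => ⟨⟨n a + 1, ?_⟩, ?_⟩⟩,
    hfin⟩
  · have h1 := (hr a).iterate_step (machine c s₀ k₀ k₁).m some none fun l => rfl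
    rw [Nat.add_comm, Function.iterate_add_apply]
    have dite_eq : ∀ (k₂ : K) (l : List (Γ k₂)), (fun k => @dite (List (Γ k)) (k = k₂)
        (‹DecidableEq K› k k₂) (fun h => by rw [h]; exact l) fun _ => []) =
        Function.update (fun _ => []) k₂ l := by
      intro k₂ l
      funext k
      by_cases hk : k = k₂
      · subst hk
        simp
      · simp [hk]
    have hi : Turing.initList (machine c s₀ k₀ k₁) ((enc a).map e₀.invFun) =
        ⟨some (some c.entry), s₀, Function.update (fun _ => []) k₀ ((enc a).map e₀.symm)⟩ :=
      congrArg (Turing.TM2.Cfg.mk _ _) (dite_eq k₀ _)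
    have ho : Turing.haltList (machine c s₀ k₀ k₁) [e₁.invFun (f a)] =
        ⟨none, s₀, Function.update (fun _ => []) k₁ [e₁.symm (f a)]⟩ :=
      congrArg (Turing.TM2.Cfg.mk _ _) (dite_eq k₁ _)
    refine Eq.trans ?_ (congrArg some ho).symm
    exact congrArg (flip bind (Turing.TM2.step (machine c s₀ k₀ k₁).m))
      ((congrArg (fun x => (flip bind (Turing.TM2.step (machine c s₀ k₀ k₁).m))^[n a] (some x))
        hi).trans h1)
  · simpa using hn a

end StackProgram

/-! ### Execution with time bounds. -/

namespace StackProgram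

section Exec

variable {K : Type} {Γ : K → Type} {σ : Type} [DecidableEq K]

/-- The program `c` transforms the stacks `S` into `S'` in at most `N` steps,
whatever the register contains. -/
def Exec (c : Cmd Γ σ) (S S' : ∀ k, List (Γ k)) (N : ℕ) : Prop :=
  ∀ s, ∃ s' n, n ≤ N ∧ Runs c s S s' S' n

variable {S S₁ S₂ : ∀ k, List (Γ k)} {N N₁ N₂ : ℕ}

theorem Exec.seq {a b : Cmd Γ σ} (ha : Exec a S S₁ N₁) (hb : Exec b S₁ S₂ N₂) :
    Exec (.seq a b) S S₂ (N₁ + N₂) := fun s => by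
  obtain ⟨s₁, n₁, h₁, r₁⟩ := ha s
  obtain ⟨s₂, n₂, h₂, r₂⟩ := hb s₁
  exact ⟨s₂, _, by omega, r₁.seq r₂⟩

theorem Exec.mono {a : Cmd Γ σ} (ha : Exec a S S₁ N₁) (h : N₁ ≤ N₂) : Exec a S S₁ N₂ := fun s => by
  obtain ⟨s₁, n₁, h₁, r₁⟩ := ha s
  exact ⟨s₁, n₁, h₁.trans h, r₁⟩

theorem Exec.push_const (k : K) (a : Γ k) (S : ∀ k, List (Γ k)) :
    Exec (.push k fun _ => a : Cmd Γ σ) S (Function.update S k (a :: S k)) 1 :=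
  fun s => ⟨s, 1, le_rfl, .push k _ s S⟩

/-- The rule for loops that empty a stack, with an invariant that depends on what is left. -/
theorem exec_loop {k : K} {f : σ → Option (Γ k) → σ} {t : σ → Bool} {body : Cmd Γ σ}
    {J : List (Γ k) → (∀ k, List (Γ k)) → Prop} (hJ : ∀ l S, J l S → S k = l)
    (h0 : ∀ s, t (f s none) = false) (h1 : ∀ s a, t (f s (some a)) = true)
    (hb : ∀ a l S s, J (a :: l) S → ∃ s' S' n, J l S' ∧ n ≤ N ∧
      Runs body (f s (some a)) (Function.update S k l) s' S' n) (hfin : ∀ S', J [] S' → S' = S₁)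
    {l : List (Γ k)} (hS : J l S) : Exec (.loop k f t body) S S₁ (l.length * (N + 1) + 1) := by
  intro s
  induction l generalizing S s with
  | nil =>
    obtain rfl := hfin S hS
    have hk := hJ _ _ hS
    refine ⟨f s (S k).head?, 1, by simp, ?_⟩
    have := Runs.loop_exit (k := k) (f := f) (t := t) (a := body) (s := s) (S := S)
      (by rw [hk]; exact h0 s)
    have e : Function.update S k (S k).tail = S := by rw [hk, List.tail_nil, ← hk]; simp
    rwa [e] at this
  | cons a l ih =>
    have hk := hJ _ _ hS
    obtain ⟨s', S', n, hJ', hn, hr⟩ := hb a l S s hS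
    obtain ⟨s'', n', hn', hr'⟩ := ih hJ' s'
    refine ⟨s'', 1 + n + n', ?_, Runs.loop_step (s₁ := s') (S₁ := S') ?_ ?_ hr'⟩
    · rw [List.length_cons]
      linarith
    · rw [hk]
      exact h1 s a
    · rw [hk]
      exact hr

/-- Moving a stack onto another one. -/
theorem exec_transfer {k k' : K} (hk : k ≠ k') {f : σ → Option (Γ k) → σ} {t : σ → Bool}
    {g : σ → Γ k'} (e : Γ k → Γ k') (h0 : ∀ s, t (f s none) = false)
    (h1 : ∀ s a, t (f s (some a)) = true) (hg : ∀ s a, g (f s (some a)) = e a)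
    (S : ∀ k, List (Γ k)) :
    Exec (.loop k f t (.push k' g)) S
      (Function.update (Function.update S k []) k' (((S k).map e).reverse ++ S k'))
      ((S k).length * 2 + 1) := by
  refine exec_loop (N := 1) (J := fun l S' => ∃ p, p ++ l = S k ∧ S' =
    Function.update (Function.update S k l) k' ((p.map e).reverse ++ S k')) ?_ h0 h1 ?_ ?_
    (l := S k) ⟨[], rfl, by simp⟩
  · rintro l S' ⟨p, -, rfl⟩
    simp [hk]
  · rintro a l S' s ⟨p, hp, rfl⟩
    refine ⟨_, _, _, ?_, le_rfl, Runs.push _ _ _ _⟩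
    refine ⟨p ++ [a], by simpa using hp, ?_⟩
    rw [hg]
    funext k''
    by_cases e1 : k'' = k'
    · subst e1
      simp [hk.symm]
    · by_cases e2 : k'' = k
      · subst e2
        simp [e1]
      · simp [e1, e2]
  · rintro S' ⟨p, hp, rfl⟩
    rw [List.append_nil] at hp
    rw [hp]

/-- Emptying a stack. -/
theorem exec_clear {k : K} {f : σ → Option (Γ k) → σ} {t : σ → Bool} {g : σ → σ}
    (h0 : ∀ s, t (f s none) = false) (h1 : ∀ s a, t (f s (some a)) = true)
    (S : ∀ k, List (Γ k)) :
    Exec (.loop k f t (.load g)) S (Function.update S k []) ((S k).length * 2 + 1) := by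
  refine exec_loop (N := 1) (J := fun l S' => S' = Function.update S k l) ?_ h0 h1 ?_ ?_
    (l := S k) (by simp)
  · rintro l S' rfl
    simp
  · rintro a l S' s rfl
    exact ⟨_, _, _, by simp, le_rfl, Runs.load _ _ _⟩
  · rintro S' rfl
    rfl

end Exec

/-! ### Stacks, counters and registers of the decision machines. -/

/-- The counters of the machines below: a scratch counter and four variables, each given by its
value and by the number of remaining values. -/
inductive Cnt
  | sc
  | val (v : Fin 4)
  | rest (v : Fin 4)
  deriving DecidableEq, Fintype

/-- The stacks of the machines below: the input and its reversal, two tapes with a scratch tape,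
the counters, and a stack of truth values. -/
inductive Stk
  | inp
  | aux
  | tape (g : Bool)
  | rev
  | cnt (c : Cnt)
  | acc
  deriving DecidableEq, Fintype

/-- The alphabets of the stacks. -/
abbrev Alph (Γ₀ : Type) : Stk → Type
  | .inp => Γ₀
  | .aux => Γ₀
  | .tape _ => Option Bool
  | .rev => Option Bool
  | .cnt _ => Bool
  | .acc => Bool

instance (Γ₀ : Type) [Fintype Γ₀] : ∀ k, Fintype (Alph Γ₀ k)
  | .inp => inferInstanceAs (Fintype Γ₀)
  | .aux => inferInstanceAs (Fintype Γ₀)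
  | .tape _ => inferInstanceAs (Fintype (Option Bool))
  | .rev => inferInstanceAs (Fintype (Option Bool))
  | .cnt _ => inferInstanceAs (Fintype Bool)
  | .acc => inferInstanceAs (Fintype Bool)

/-- The registers: an input symbol, a tape symbol and two truth values. -/
structure Reg (Γ₀ : Type) where
  inp : Option Γ₀
  sym : Option (Option Bool)
  fst : Option Bool
  snd : Option Bool

/-- A register as a tuple. -/
def Reg.equivProd (Γ₀ : Type) :
    Reg Γ₀ ≃ Option Γ₀ × Option (Option Bool) × Option Bool × Option Bool where
  toFun s := (s.inp, s.sym, s.fst, s.snd)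
  invFun t := ⟨t.1, t.2.1, t.2.2.1, t.2.2.2⟩

instance (Γ₀ : Type) [Fintype Γ₀] : Fintype (Reg Γ₀) :=
  Fintype.ofEquiv _ (Reg.equivProd Γ₀).symm

variable {Γ₀ : Type}

/-- Programs for these stacks and registers. -/
abbrev Prog (Γ₀ : Type) : Type := Cmd (Alph Γ₀) (Reg Γ₀)

/-- The stored tape symbol. -/
def Reg.cell (s : Reg Γ₀) : Option Bool := s.sym.getD none

/-- Stack contents, with counters as numbers. -/
structure Conf (Γ₀ : Type) where
  inp : List Γ₀
  aux : List Γ₀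
  tape : Bool → List (Option Bool)
  rev : List (Option Bool)
  cnt : Cnt → ℕ
  acc : List Bool

namespace Conf

/-- The stacks of a configuration. -/
def stk (C : Conf Γ₀) : ∀ k, List (Alph Γ₀ k)
  | .inp => C.inp
  | .aux => C.aux
  | .tape g => C.tape g
  | .rev => C.rev
  | .cnt c => List.replicate (C.cnt c) true
  | .acc => C.acc

variable (C : Conf Γ₀)

theorem update_inp (l) : Function.update C.stk .inp l = { C with inp := l }.stk := by
  funext k
  cases k <;> simp [stk]

theorem update_aux (l) : Function.update C.stk .aux l = { C with aux := l }.stk := by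
  funext k
  cases k <;> simp [stk]

theorem update_rev (l) : Function.update C.stk .rev l = { C with rev := l }.stk := by
  funext k
  cases k <;> simp [stk]

theorem update_acc (l) : Function.update C.stk .acc l = { C with acc := l }.stk := by
  funext k
  cases k <;> simp [stk]

theorem update_tape (g l) : Function.update C.stk (.tape g) l =
    { C with tape := Function.update C.tape g l }.stk := by
  funext k
  rcases k with _ | _ | g' | _ | _ | _
  case tape =>
    by_cases h : g' = g
    · subst h
      simp [stk]
    · simp [stk, h]
  all_goals simp [stk]

theorem update_cnt (c m) : Function.update C.stk (.cnt c) (List.replicate m true) =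
    { C with cnt := Function.update C.cnt c m }.stk := by
  funext k
  rcases k with _ | _ | _ | _ | c' | _
  case cnt =>
    by_cases h : c' = c
    · subst h
      simp [stk]
    · simp [stk, h]
  all_goals simp [stk]

end Conf

/-- Repeat the body while a counter can be decreased. -/
def countdown (c : Cnt) (body : Prog Γ₀) : Prog Γ₀ :=
  .loop (.cnt c) (fun s o => { s with fst := o }) (fun s => s.fst.isSome) body

/-- `F i` is the configuration after i passes. Each pass pops the counter before it runs the body,
so the body starts with m − (i + 1) on it. -/
theorem exec_countdown {c : Cnt} {body : Prog Γ₀} (F : ℕ → Conf Γ₀) {m N : ℕ}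
    (hF : ∀ i, (F i).cnt c = m - i)
    (hb : ∀ i < m, Exec body
      { F i with cnt := Function.update (F i).cnt c (m - (i + 1)) }.stk (F (i + 1)).stk N) :
    Exec (countdown c body) (F 0).stk (F m).stk (m * (N + 1) + 1) := by
  have := exec_loop (k := Stk.cnt c) (N := N) (body := body) (S := (F 0).stk) (S₁ := (F m).stk)
    (f := fun (s : Reg Γ₀) o => { s with fst := o }) (t := fun s => s.fst.isSome)
    (J := fun l S => ∃ i ≤ m, l = List.replicate (m - i) true ∧ S = (F i).stk)
    (l := List.replicate m true) ?_ (fun _ => rfl) (fun _ _ => rfl) ?_ ?_ ⟨0, by simp⟩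
  · rwa [List.length_replicate] at this
  · rintro l S ⟨i, -, rfl, rfl⟩
    simp [Conf.stk, hF]
  · rintro a l S s ⟨i, hi, hl, rfl⟩
    have him : i < m := by
      by_contra hcon
      rw [Nat.sub_eq_zero_of_le (not_lt.1 hcon)] at hl
      simp at hl
    have hl' : l = List.replicate (m - (i + 1)) true := by
      rw [show m - i = (m - (i + 1)) + 1 by omega, List.replicate_succ] at hl
      exact (List.cons.inj hl).2
    obtain ⟨s', n, hn, hr⟩ := hb i him { s with fst := some a }
    refine ⟨s', _, n, ⟨i + 1, him, hl', rfl⟩, hn, ?_⟩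
    rw [hl', Conf.update_cnt]
    exact hr
  · rintro S ⟨i, hi, hl, rfl⟩
    have : m - i = 0 := by simpa using congrArg List.length hl.symm
    rw [show i = m by omega]

theorem exec_incr (c : Cnt) (C : Conf Γ₀) : Exec (.push (.cnt c) fun _ => true : Prog Γ₀) C.stk
    { C with cnt := Function.update C.cnt c (C.cnt c + 1) }.stk 1 := by
  rw [← Conf.update_cnt, List.replicate_succ]
  exact Exec.push_const _ _ _

/-- Move the contents of a counter to another one. -/
def moveCnt (c c' : Cnt) : Prog Γ₀ :=
  countdown c (.push (.cnt c') fun _ => true)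

theorem exec_moveCnt {c c' : Cnt} (h : c ≠ c') (C : Conf Γ₀) :
    Exec (moveCnt c c') C.stk
      { C with cnt := Function.update (Function.update C.cnt c 0) c' (C.cnt c + C.cnt c') }.stk
      (C.cnt c * 2 + 1) := by
  have := exec_countdown (c := c) (body := .push (.cnt c') fun _ => true) (m := C.cnt c) (N := 1)
    (fun i =>
      { C with
        cnt := Function.update (Function.update C.cnt c (C.cnt c - i)) c' (i + C.cnt c') })
    (fun i => by simp [h]) (fun i hi => by
      convert exec_incr c' _ using 2
      simp only [Conf.mk.injEq, true_and, and_true]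
      funext d
      by_cases h1 : d = c'
      · subst h1
        simp [h.symm]
        omega
      · by_cases h2 : d = c
        · subst h2
          simp [h1]
        · simp [h1, h2])
  simp only [Nat.sub_zero, Nat.sub_self, Function.update_eq_self, zero_add] at this
  exact this

/-! ### Lookup in an adjacency matrix. -/

/-- Read a symbol of a tape. -/
def readCell (g : Bool) : Prog Γ₀ :=
  .seq (.pop (.tape g) fun s o => { s with sym := o }) (.push .rev fun s => s.cell)

theorem exec_readCell {g : Bool} {C : Conf Γ₀} {a r} (h : C.tape g = a :: r) :
    Exec (readCell g) C.stk
      { C with tape := Function.update C.tape g r, rev := a :: C.rev }.stk 2 := by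
  intro s
  refine ⟨{ s with sym := some a }, 2, le_rfl, Runs.seq (n₁ := 1) (n₂ := 1) (Runs.pop _ _ _ _) ?_⟩
  have h1 : C.stk (.tape g) = a :: r := h
  rw [h1, List.tail_cons, Conf.update_tape, List.head?_cons]
  have h2 := Runs.push (Γ := Alph Γ₀) Stk.rev (fun s : Reg Γ₀ => s.cell) { s with sym := some a }
    { C with tape := Function.update C.tape g r }.stk
  rw [Conf.update_rev] at h2
  exact h2

/-- Read a row of a tape, with the mark at its end. -/
def readRow (g : Bool) : Prog Γ₀ :=
  .seq (.loop (.tape g) (fun s o => { s with sym := o }) (fun s => s.cell.isSome)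
    (.push .rev fun s => s.cell)) (.push .rev fun _ => none)

theorem exec_readRow {g : Bool} (row : List Bool) {C : Conf Γ₀} {r}
    (h : C.tape g = row.map some ++ none :: r) :
    Exec (readRow g) C.stk
      { C with
        tape := Function.update C.tape g r
        rev := none :: (row.map some).reverse ++ C.rev }.stk (row.length * 2 + 2) := by
  -- The loop pops the end mark without recording it; the push after the loop puts it on the scratch
  -- tape.
  have key : Exec (.loop (.tape g) (fun s o => { s with sym := o }) (fun s => s.cell.isSome)
      (.push .rev fun s => s.cell) : Prog Γ₀) C.stk
      { C with
        tape := Function.update C.tape g r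
        rev := (row.map some).reverse ++ C.rev }.stk (row.length * 2 + 1) := by
    induction row generalizing C with
    | nil =>
      intro s
      have h1 : C.stk (.tape g) = none :: r := h
      refine ⟨{ s with sym := some none }, 1, by simp, ?_⟩
      have h2 := Runs.loop_exit (Γ := Alph Γ₀) (k := Stk.tape g)
        (f := fun (s : Reg Γ₀) o => { s with sym := o }) (t := fun s => s.cell.isSome)
        (a := .push .rev fun s => s.cell) (s := s) (S := C.stk) (by rw [h1]; rfl)
      rw [h1, List.tail_cons, Conf.update_tape] at h2
      exact h2
    | cons b row ih =>
      intro s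
      have h1 : C.stk (.tape g) = some b :: (row.map some ++ none :: r) := h
      obtain ⟨s', n, hn, hr⟩ := ih (C := { C with
        tape := Function.update C.tape g (row.map some ++ none :: r)
        rev := some b :: C.rev }) (by simp) { s with sym := some (some b) }
      refine ⟨s', 1 + 1 + n, by rw [List.length_cons]; omega,
        Runs.loop_step (by rw [h1]; rfl) (Runs.push _ _ _ _) ?_⟩
      rw [h1, List.tail_cons, Conf.update_tape, Conf.update_rev]
      simp only [Function.update_idem, List.map_cons, List.reverse_cons, List.append_assoc,
        List.singleton_append] at hr ⊢
      exact hr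
  have h2 := key.seq (Exec.push_const (σ := Reg Γ₀) Stk.rev none _)
  rw [Conf.update_rev] at h2
  exact h2

/-- The rows of an adjacency matrix as written on a tape. -/
def writtenRows (B : List (List Bool)) : List (List (Option Bool)) :=
  B.map fun row => row.map some ++ [none]

/-- Go to the row of the matrix on a tape that is given by a variable. -/
def seekRow (g : Bool) (v : Fin 4) : Prog Γ₀ :=
  .seq (countdown (.val v) (.seq (.push (.cnt .sc) fun _ => true) (readRow g)))
    (moveCnt .sc (.val v))

/-- Go to the entry of the current row that is given by a variable. -/
def seekCol (g : Bool) (v : Fin 4) : Prog Γ₀ :=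
  .seq (countdown (.val v) (.seq (.push (.cnt .sc) fun _ => true) (readCell g)))
    (moveCnt .sc (.val v))

/-- The rows passed over are kept in reverse on the scratch tape, and the value of the variable is
rebuilt from the scratch counter, so nothing is lost. -/
theorem exec_seekRow {g : Bool} {v : Fin 4} {C : Conf Γ₀} {B : List (List Bool)} {n : ℕ}
    (hB : ∀ row ∈ B, row.length = n) (hC : C.tape g = (writtenRows B).flatten)
    (hrev : C.rev = []) (hsc : C.cnt .sc = 0) (hv : C.cnt (.val v) ≤ B.length) :
    Exec (seekRow g v) C.stk
      { C with
        tape := Function.update C.tape g ((writtenRows B).drop (C.cnt (.val v))).flatten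
        rev := ((writtenRows B).take (C.cnt (.val v))).flatten.reverse }.stk
      (C.cnt (.val v) * (2 * n + 4) + 1 + (C.cnt (.val v) * 2 + 1)) := by
  set m := C.cnt (.val v) with hm
  set F : ℕ → Conf Γ₀ := fun i =>
    { C with
      tape := Function.update C.tape g ((writtenRows B).drop i).flatten
      rev := ((writtenRows B).take i).flatten.reverse
      cnt := Function.update (Function.update C.cnt (.val v) (m - i)) .sc i } with hF
  have h1 := exec_countdown (c := .val v) (m := m) (N := 2 * n + 3)
    (body := .seq (.push (.cnt .sc) fun _ => true) (readRow g)) F (fun i => by simp [hF])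
    (fun i hi => by
      have hi' : i < B.length := by omega
      have hiw : i < (writtenRows B).length := by simpa [writtenRows] using hi'
      have hrow : (writtenRows B)[i] = B[i].map some ++ [none] := by simp [writtenRows]
      have h := (exec_incr .sc { F i with
        cnt := Function.update (F i).cnt (.val v) (m - (i + 1)) }).seq
        (exec_readRow (g := g) B[i] (r := ((writtenRows B).drop (i + 1)).flatten)
          (by simp [hF, List.drop_eq_getElem_cons hiw, hrow]))
      refine Exec.mono (N₁ := 1 + (B[i].length * 2 + 2)) ?_ ?_
      swap
      · rw [hB _ (List.getElem_mem hi')]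
        omega
      · convert h using 2
        simp only [hF, Conf.mk.injEq, true_and, and_true]
        refine ⟨by simp, ?_, ?_⟩
        · rw [List.take_add_one]
          simp [List.getElem?_eq_getElem hiw, hrow]
        · funext d
          by_cases h1 : d = .sc
          · subst h1
            simp
          · by_cases h2 : d = .val v
            · subst h2
              simp
            · simp [h1, h2])
  have h2 := exec_moveCnt (c := .sc) (c' := .val v) (by simp) (F m)
  have e0 : F 0 = C := by
    have ec : Function.update C.cnt .sc 0 = C.cnt := by rw [← hsc, Function.update_eq_self]
    have et : Function.update C.tape g (writtenRows B).flatten = C.tape := by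
      rw [← hC, Function.update_eq_self]
    simp only [hF, hm, ec, et, Nat.sub_zero, Function.update_eq_self, List.drop_zero,
      List.take_zero, List.flatten_nil, List.reverse_nil]
    rw [← hrev]
  have e1 : (F m).cnt .sc = m := by simp [hF]
  rw [e0] at h1
  rw [e1] at h2
  have h := h1.seq h2
  rw [seekRow]
  convert h using 2
  simp only [hF, Conf.mk.injEq, true_and, and_true]
  funext d
  by_cases h1 : d = .val v
  · subst h1
    simp [hm]
  · by_cases h2 : d = .sc
    · subst h2
      simp [hsc]
    · simp [h1, h2]

theorem exec_seekCol {g : Bool} {v : Fin 4} {C : Conf Γ₀} {row : List Bool} {r}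
    (hC : C.tape g = row.map some ++ r) (hsc : C.cnt .sc = 0)
    (hv : C.cnt (.val v) ≤ row.length) :
    Exec (seekCol g v) C.stk
      { C with
        tape := Function.update C.tape g ((row.drop (C.cnt (.val v))).map some ++ r)
        rev := ((row.take (C.cnt (.val v))).map some).reverse ++ C.rev }.stk
      (C.cnt (.val v) * 4 + 1 + (C.cnt (.val v) * 2 + 1)) := by
  set m := C.cnt (.val v) with hm
  set F : ℕ → Conf Γ₀ := fun i =>
    { C with
      tape := Function.update C.tape g ((row.drop i).map some ++ r)
      rev := ((row.take i).map some).reverse ++ C.rev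
      cnt := Function.update (Function.update C.cnt (.val v) (m - i)) .sc i } with hF
  have h1 := exec_countdown (c := .val v) (m := m) (N := 3)
    (body := .seq (.push (.cnt .sc) fun _ => true) (readCell g)) F (fun i => by simp [hF])
    (fun i hi => by
      have hi' : i < row.length := by omega
      have h := (exec_incr .sc { F i with
        cnt := Function.update (F i).cnt (.val v) (m - (i + 1)) }).seq
        (exec_readCell (g := g) (a := some row[i]) (r := (row.drop (i + 1)).map some ++ r)
          (by
            simp only [hF, Function.update_self]
            rw [List.drop_eq_getElem_cons hi', List.map_cons, List.cons_append]))
      convert h using 2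
      simp only [hF, Conf.mk.injEq, true_and, and_true]
      refine ⟨by simp, ?_, ?_⟩
      · rw [List.take_add_one, List.getElem?_eq_getElem hi']
        simp only [Option.toList_some, List.map_append, List.map_cons, List.map_nil,
          List.reverse_append, List.reverse_cons, List.reverse_nil, List.nil_append,
          List.cons_append]
      · funext d
        by_cases h1 : d = .sc
        · subst h1
          simp
        · by_cases h2 : d = .val v
          · subst h2
            simp
          · simp [h1, h2])
  have h2 := exec_moveCnt (c := .sc) (c' := .val v) (by simp) (F m)
  have e0 : F 0 = C := by
    have ec : Function.update C.cnt .sc 0 = C.cnt := by rw [← hsc, Function.update_eq_self]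
    have et : Function.update C.tape g (row.map some ++ r) = C.tape := by
      rw [← hC, Function.update_eq_self]
    simp [hF, hm, ec, et]
  have e1 : (F m).cnt .sc = m := by simp [hF]
  rw [e0] at h1
  rw [e1] at h2
  have h := h1.seq h2
  rw [seekCol]
  convert h using 2
  simp only [hF, Conf.mk.injEq, true_and, and_true]
  funext d
  by_cases h1 : d = .val v
  · subst h1
    simp [hm]
  · by_cases h2 : d = .sc
    · subst h2
      simp [hsc]
    · simp [h1, h2]

/-- Read an entry of the matrix on a tape and note it as a truth value. -/
def noteEntry (g : Bool) : Prog Γ₀ :=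
  .seq (readCell g) (.push .acc fun s => s.cell.getD false)

theorem exec_noteEntry {g : Bool} {C : Conf Γ₀} {b : Bool} {r} (h : C.tape g = some b :: r) :
    Exec (noteEntry g) C.stk
      { C with
        tape := Function.update C.tape g r
        rev := some b :: C.rev
        acc := b :: C.acc }.stk 3 := by
  intro s
  refine ⟨{ s with sym := some (some b) }, 2 + 1, le_rfl,
    Runs.seq (Runs.seq (n₁ := 1) (n₂ := 1) (Runs.pop _ _ _ _) (Runs.push _ _ _ _)) ?_⟩
  have h1 : C.stk (.tape g) = some b :: r := h
  rw [h1, List.tail_cons, Conf.update_tape, Conf.update_rev, List.head?_cons]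
  have h2 := Runs.push (Γ := Alph Γ₀) Stk.acc (fun s : Reg Γ₀ => s.cell.getD false)
    { s with sym := some (some b) }
    { C with tape := Function.update C.tape g r, rev := some b :: C.rev }.stk
  rw [Conf.update_acc] at h2
  exact h2

/-- Restore a tape. -/
def unwind (g : Bool) : Prog Γ₀ :=
  .loop .rev (fun s o => { s with sym := o }) (fun s => s.sym.isSome)
    (.push (.tape g) fun s => s.cell)

theorem exec_unwind (g : Bool) (C : Conf Γ₀) :
    Exec (unwind g) C.stk
      { C with
        tape := Function.update C.tape g (C.rev.reverse ++ C.tape g)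
        rev := [] }.stk (C.rev.length * 2 + 1) := by
  have h := exec_transfer (Γ := Alph Γ₀) (k := Stk.rev) (k' := Stk.tape g) (by simp)
    (f := fun (s : Reg Γ₀) o => { s with sym := o }) (t := fun s => s.sym.isSome)
    (g := fun s => s.cell) id (fun _ => rfl) (fun _ _ => rfl) (fun _ _ => rfl) C.stk
  rw [Conf.update_rev, Conf.update_tape] at h
  simp only [List.map_id] at h
  exact h

/-- Note whether there is an edge between two variables. -/
def query (g : Bool) (v w : Fin 4) : Prog Γ₀ :=
  .seq (seekRow g v) (.seq (seekCol g w) (.seq (noteEntry g) (unwind g)))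

/-- The net effect is one more truth value on the stack: everything read from the tape lies on the
scratch tape and is put back. -/
theorem exec_query {g : Bool} {v w : Fin 4} {C : Conf Γ₀} {B : List (List Bool)} {n : ℕ}
    (hB : ∀ row ∈ B, row.length = n) (hC : C.tape g = (writtenRows B).flatten)
    (hrev : C.rev = []) (hsc : C.cnt .sc = 0) (hv : C.cnt (.val v) < B.length)
    (hw : C.cnt (.val w) < (B[C.cnt (.val v)]).length) (hBn : B.length ≤ n) :
    Exec (query g v w) C.stk
      { C with acc := (B[C.cnt (.val v)])[C.cnt (.val w)] :: C.acc }.stk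
      ((n + 1) * (2 * n + 8) + (n + 1) * 8 + 3 + ((writtenRows B).flatten.length * 2 + 1)) := by
  set i := C.cnt (.val v) with hi
  set j := C.cnt (.val w) with hj
  have hiw : i < (writtenRows B).length := by simpa [writtenRows] using hv
  have hrow : (writtenRows B)[i] = B[i].map some ++ [none] := by simp [writtenRows]
  have hn : B[i].length = n := hB _ (List.getElem_mem hv)
  have h1 := exec_seekRow hB hC hrev hsc hv.le
  rw [← hi] at h1
  have h2 := exec_seekCol (g := g) (v := w) (row := B[i])
    (r := none :: ((writtenRows B).drop (i + 1)).flatten)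
    (C := { C with
      tape := Function.update C.tape g ((writtenRows B).drop i).flatten
      rev := ((writtenRows B).take i).flatten.reverse })
    (by simp [List.drop_eq_getElem_cons hiw, hrow]) hsc hw.le
  dsimp only at h2
  rw [← hj] at h2
  have h3 := exec_noteEntry (g := g) (b := (B[i])[j])
    (r := (B[i].drop (j + 1)).map some ++ none :: ((writtenRows B).drop (i + 1)).flatten)
    (C := { C with
      tape := Function.update (Function.update C.tape g ((writtenRows B).drop i).flatten) g
        ((B[i].drop j).map some ++ none :: ((writtenRows B).drop (i + 1)).flatten)
      rev := ((B[i].take j).map some).reverse ++ ((writtenRows B).take i).flatten.reverse })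
    (by simp only [Function.update_self]; rw [List.drop_eq_getElem_cons hw]; rfl)
  have h4 := exec_unwind g
    { C with
      tape := Function.update (Function.update (Function.update C.tape g
        ((writtenRows B).drop i).flatten) g
        ((B[i].drop j).map some ++ none :: ((writtenRows B).drop (i + 1)).flatten)) g
        ((B[i].drop (j + 1)).map some ++ none :: ((writtenRows B).drop (i + 1)).flatten)
      rev := some (B[i])[j] ::
        (((B[i].take j).map some).reverse ++ ((writtenRows B).take i).flatten.reverse)
      acc := (B[i])[j] :: C.acc }
  have hword : ((writtenRows B).take i).flatten ++ ((B[i].take j).map some ++ some (B[i])[j] ::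
      ((B[i].drop (j + 1)).map some ++ none :: ((writtenRows B).drop (i + 1)).flatten)) =
      (writtenRows B).flatten := by
    have e1 : (B[i].take j).map some ++ some (B[i])[j] :: (B[i].drop (j + 1)).map some =
        B[i].map some := by
      rw [← List.map_cons, ← List.drop_eq_getElem_cons hw, ← List.map_append, List.take_append_drop]
    have e2 : (B[i].take j).map some ++ some (B[i])[j] ::
        ((B[i].drop (j + 1)).map some ++ none :: ((writtenRows B).drop (i + 1)).flatten) =
        ((writtenRows B).drop i).flatten := by
      rw [List.drop_eq_getElem_cons hiw, hrow, List.flatten_cons, ← e1]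
      simp
    rw [e2, ← List.flatten_append, List.take_append_drop]
  have h := h1.seq (h2.seq (h3.seq h4))
  refine Exec.mono (N₁ := i * (2 * n + 4) + 1 + (i * 2 + 1) + (j * 4 + 1 + (j * 2 + 1) +
    (3 + ((some (B[i])[j] :: (((B[i].take j).map some).reverse ++
      ((writtenRows B).take i).flatten.reverse)).length * 2 + 1)))) ?_ ?_
  · rw [query]
    convert h using 2
    simp only [Conf.mk.injEq, true_and]
    refine ⟨?_, hrev, rfl⟩
    funext g'
    by_cases hg : g' = g
    · subst hg
      simp only [Function.update_self, List.reverse_cons, List.reverse_append,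
        List.reverse_reverse, List.append_assoc, List.singleton_append]
      rw [hword, hC]
    · simp [hg]
  · have hlen : (some (B[i])[j] :: (((B[i].take j).map some).reverse ++
        ((writtenRows B).take i).flatten.reverse)).length ≤ (writtenRows B).flatten.length := by
      rw [← hword]
      simp
      omega
    have hin : i ≤ n := by omega
    have hjn : j ≤ n := hn ▸ hw.le
    have := Nat.mul_le_mul hin (le_refl (2 * n + 4))
    nlinarith

/-- Replace the two topmost truth values by the value of a Boolean operation. -/
def connect (f : Bool → Bool → Bool) : Prog Γ₀ :=
  .seq (.pop .acc fun s o => { s with fst := o }) (.seq (.pop .acc fun s o => { s with snd := o })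
    (.push .acc fun s => f (s.snd.getD false) (s.fst.getD false)))

theorem exec_connect (f : Bool → Bool → Bool) {C : Conf Γ₀} {a b : Bool} {r : List Bool}
    (h : C.acc = b :: a :: r) :
    Exec (connect f) C.stk { C with acc := f a b :: r }.stk 3 := by
  intro s
  have h1 : C.stk .acc = b :: a :: r := h
  have h2 : Conf.stk { C with acc := a :: r } .acc = a :: r := rfl
  refine ⟨{ s with fst := some b, snd := some a }, 1 + (1 + 1), le_rfl,
    Runs.seq (Runs.pop _ _ _ _) (Runs.seq (Runs.pop _ _ _ _) ?_)⟩
  rw [h1, List.tail_cons, Conf.update_acc, h2, List.tail_cons, Conf.update_acc, List.head?_cons,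
    List.head?_cons]
  have h3 := Runs.push (Γ := Alph Γ₀) Stk.acc
    (fun s : Reg Γ₀ => f (s.snd.getD false) (s.fst.getD false))
    { s with fst := some b, snd := some a } { C with acc := r }.stk
  rw [Conf.update_acc] at h3
  exact h3

/-! ### Properties computable in polynomial time. -/

/-- Two relations on an initial segment of the natural numbers. -/
structure Inst where
  size : ℕ
  rel : Bool → ℕ → ℕ → Prop

open scoped Classical in
/-- The matrix of one of the relations. -/
noncomputable def Inst.rows (I : Inst) (g : Bool) : List (List Bool) :=
  List.ofFn fun i : Fin I.size => List.ofFn fun j : Fin I.size => decide (I.rel g i j)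

/-- The word for the matrix of one of the relations. -/
noncomputable def Inst.word (I : Inst) (g : Bool) : List (Option Bool) :=
  (writtenRows (I.rows g)).flatten

theorem Inst.length_word (I : Inst) (g : Bool) : (I.word g).length = I.size * (I.size + 1) := by
  simp [Inst.word, Inst.rows, writtenRows, List.length_flatten, List.map_ofFn, Function.comp_def]

/-- The configuration represents two relations and an assignment of the first `d` variables. -/
structure Ready (d : ℕ) (I : Inst) (x : Fin 4 → ℕ) (C : Conf Γ₀) : Prop where
  tape : ∀ g, C.tape g = I.word g
  rev : C.rev = []
  sc : C.cnt .sc = 0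
  val : ∀ v, C.cnt (.val v) = x v
  lt : ∀ v : Fin 4, (v : ℕ) < d → x v < I.size
  zero : ∀ v : Fin 4, d ≤ (v : ℕ) → x v = 0
  rest : ∀ v : Fin 4, d ≤ (v : ℕ) → C.cnt (.rest v) = I.size

open scoped Classical in
/-- The truth value of a property of two relations and `d` elements can be computed
in polynomial time. -/
def Comp (Γ₀ : Type) (d : ℕ) (P : Inst → (Fin 4 → ℕ) → Prop) : Prop :=
  ∃ (c : Prog Γ₀) (p : Polynomial ℕ), ∀ (I : Inst) (x : Fin 4 → ℕ) (C : Conf Γ₀), Ready d I x C →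
    Exec c C.stk { C with acc := decide (P I x) :: C.acc }.stk (p.eval I.size)

namespace Comp

variable {d : ℕ} {P Q R : Inst → (Fin 4 → ℕ) → Prop}

open scoped Classical in
theorem rel (g : Bool) (v w : Fin 4) (hv : (v : ℕ) < d) (hw : (w : ℕ) < d) :
    Comp Γ₀ d fun I x => I.rel g (x v) (x w) := by
  refine ⟨query g v w, (.X + 1) * (2 * .X + 8) + (.X + 1) * 8 + 3 + (.X * (.X + 1) * 2 + 1),
    fun I x C h => ?_⟩
  have hv' : C.cnt (.val v) < I.size := by rw [h.val]; exact h.lt v hv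
  have hw' : C.cnt (.val w) < I.size := by rw [h.val]; exact h.lt w hw
  have := exec_query (g := g) (v := v) (w := w) (C := C) (B := I.rows g) (n := I.size)
    (by simp [Inst.rows, List.mem_ofFn]) (h.tape g) h.rev h.sc (by simpa [Inst.rows] using hv')
    (by simpa [Inst.rows] using hw') (by simp [Inst.rows])
  have hl := I.length_word g
  rw [Inst.word] at hl
  rw [hl] at this
  convert this using 2
  · simp [Inst.rows, h.val]
  · simp

open scoped Classical in
-- `Ready` does not constrain the stack of truth values, so operands accumulate there as in postfix
-- evaluation.
theorem op (f : Bool → Bool → Bool) (hP : Comp Γ₀ d P) (hQ : Comp Γ₀ d Q)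
    (hR : ∀ I x, decide (R I x) = f (decide (P I x)) (decide (Q I x))) : Comp Γ₀ d R := by
  obtain ⟨a, p, ha⟩ := hP
  obtain ⟨b, q, hb⟩ := hQ
  refine ⟨.seq a (.seq b (connect f)), p + (q + 3), fun I x C h => ?_⟩
  have h' : Ready d I x { C with acc := decide (P I x) :: C.acc } := { h with }
  have := (ha I x C h).seq ((hb I x _ h').seq (exec_connect f rfl))
  rw [hR]
  simpa using this

theorem and (hP : Comp Γ₀ d P) (hQ : Comp Γ₀ d Q) : Comp Γ₀ d fun I x => P I x ∧ Q I x :=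
  op (fun a b => a && b) hP hQ fun I x => by
    by_cases h : P I x <;> by_cases h' : Q I x <;> simp [h, h']

theorem or (hP : Comp Γ₀ d P) (hQ : Comp Γ₀ d Q) : Comp Γ₀ d fun I x => P I x ∨ Q I x :=
  op (fun a b => a || b) hP hQ fun I x => by
    by_cases h : P I x <;> by_cases h' : Q I x <;> simp [h, h']

theorem imp (hP : Comp Γ₀ d P) (hQ : Comp Γ₀ d Q) : Comp Γ₀ d fun I x => P I x → Q I x :=
  op (fun a b => !a || b) hP hQ fun I x => by
    by_cases h : P I x <;> by_cases h' : Q I x <;> simp [h, h']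

theorem iff (hP : Comp Γ₀ d P) (hQ : Comp Γ₀ d Q) : Comp Γ₀ d fun I x => P I x ↔ Q I x :=
  op (fun a b => a == b) hP hQ fun I x => by
    by_cases h : P I x <;> by_cases h' : Q I x <;> simp [h, h']

theorem not (hP : Comp Γ₀ d P) : Comp Γ₀ d fun I x => ¬ P I x :=
  -- The second operand is a dummy; evaluating P twice only doubles its cost.
  op (fun a _ => !a) hP hP fun I x => by simp

open scoped Classical in
-- The loop moves one unit at a time from the remaining count of v to its value and accumulates a
-- conjunction. The body may find the remaining count of v below n, since `Ready (v + 1)` constrains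
-- these counts only for later variables.
theorem all (v : Fin 4) (hP : Comp Γ₀ (v + 1) P) :
    Comp Γ₀ v fun I x => ∀ y < I.size, P I (Function.update x v y) := by
  obtain ⟨b, p, hb⟩ := hP
  refine ⟨.seq (.push .acc fun _ => true) (.seq (countdown (.rest v)
    (.seq b (.seq (connect fun a b => a && b) (.push (.cnt (.val v)) fun _ => true))))
    (moveCnt (.val v) (.rest v))), 1 + (.X * (p + 4 + 1) + 1 + (.X * 2 + 1)), fun I x C h => ?_⟩
  set n := I.size with hn
  set F : ℕ → Conf Γ₀ := fun i =>
    { C with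
      cnt := Function.update (Function.update C.cnt (.rest v) (n - i)) (.val v) i
      acc := decide (∀ y < i, P I (Function.update x v y)) :: C.acc } with hF
  have h0 : C.cnt (.val v) = 0 := by rw [h.val, h.zero v le_rfl]
  have h1 := exec_countdown (c := .rest v) (m := n) (N := p.eval n + 4)
    (body := .seq b (.seq (connect fun a b => a && b) (.push (.cnt (.val v)) fun _ => true)))
    F (fun i => by simp [hF]) (fun i hi => by
      have hr : Ready (v + 1) I (Function.update x v i)
          { F i with cnt := Function.update (F i).cnt (.rest v) (n - (i + 1)) } := by
        constructor
        · exact h.tape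
        · exact h.rev
        · simp [hF, h.sc]
        · intro w
          by_cases hw : w = v
          · subst hw
            simp [hF]
          · simp [hF, hw, h.val]
        · intro w hw
          by_cases hwv : w = v
          · subst hwv
            simpa using hi
          · rw [Function.update_of_ne hwv]
            exact h.lt w (by have := Fin.val_ne_of_ne hwv; omega)
        · intro w hw
          have hwv : w ≠ v := by rintro rfl; omega
          rw [Function.update_of_ne hwv]
          exact h.zero w (by omega)
        · intro w hw
          have hwv : w ≠ v := by rintro rfl; omega
          simp [hF, hwv, h.rest w (by omega), hn]
      have h := (hb I _ _ hr).seq ((exec_connect (fun a b => a && b) rfl).seq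
        (exec_incr (.val v) _))
      convert h using 2
      simp only [hF, Conf.mk.injEq, true_and]
      constructor
      · funext c
        by_cases h1 : c = .val v
        · subst h1
          simp
        · by_cases h2 : c = .rest v
          · subst h2
            simp
          · simp [h1, h2]
      · rw [List.cons.injEq]
        refine ⟨?_, rfl⟩
        rw [← Bool.decide_and, decide_eq_decide]
        constructor
        · intro h
          exact ⟨fun y hy => h y (by omega), h i (by omega)⟩
        · rintro ⟨h1, h2⟩ y hy
          rcases Nat.lt_succ_iff_lt_or_eq.1 hy with hy | rfl
          exacts [h1 y hy, h2])
  -- After n passes the value is n and nothing remains; moving it back restores both counters for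
  -- the next use of v.
  have h2 := exec_moveCnt (c := .val v) (c' := .rest v) (by simp) (F n)
  have e0 : F 0 = { C with acc := true :: C.acc } := by
    simp only [hF, Conf.mk.injEq, true_and]
    refine ⟨?_, by simp⟩
    funext c
    by_cases h1 : c = .val v
    · subst h1
      simp [h0]
    · by_cases h2 : c = .rest v
      · subst h2
        simp [h.rest v le_rfl, hn]
      · simp [h1, h2]
  have h3 := Exec.push_const (σ := Reg Γ₀) Stk.acc true C.stk
  rw [Conf.update_acc] at h3
  rw [e0] at h1
  have h4 := h3.seq (h1.seq h2)
  have e1 : (F n).cnt (.val v) = n := by simp [hF]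
  have e2 : (F n).cnt (.rest v) = 0 := by simp [hF]
  rw [e1, e2] at h4
  convert h4 using 2
  · simp only [hF, Conf.mk.injEq, true_and]
    refine ⟨?_, by simp [hn]⟩
    funext c
    by_cases h1 : c = .rest v
    · subst h1
      simp [h.rest v le_rfl, hn]
    · by_cases h2 : c = .val v
      · subst h2
        simp [h0]
      · simp [h1, h2]
  · simp

end Comp

/-! ### Input, clean-up and the complete machine. -/

/-- Counters with the number `m` of remaining values for each variable. -/
def counters (m : ℕ) : Cnt → ℕ
  | .rest _ => m
  | _ => 0

/-- Set the number of remaining values of each variable by one up. -/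
def incrRest : Prog Γ₀ :=
  .seq (.push (.cnt (.rest 0)) fun _ => true) (.seq (.push (.cnt (.rest 1)) fun _ => true)
    (.seq (.push (.cnt (.rest 2)) fun _ => true) (.push (.cnt (.rest 3)) fun _ => true)))

theorem exec_incrRest {C : Conf Γ₀} {m : ℕ} (h : C.cnt = counters m) :
    Exec incrRest C.stk { C with cnt := counters (m + 1) }.stk 4 := by
  have := (exec_incr (.rest 0) C).seq ((exec_incr (.rest 1) _).seq ((exec_incr (.rest 2) _).seq
    (exec_incr (.rest 3) _)))
  rw [incrRest]
  convert this using 2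
  simp only [Conf.mk.injEq, true_and, and_true]
  rw [h]
  funext c
  rcases c with _ | v | v
  · simp [counters]
  · simp [counters]
  · fin_cases v <;> simp [counters]

/-- Write the stored input symbol on a tape, if it belongs there. -/
def storeOn (tp : Γ₀ → Bool → Option (Option Bool)) (g : Bool) : Prog Γ₀ :=
  .ite (fun s => (s.inp.bind fun a => tp a g).isSome)
    (.push (.tape g) fun s => (s.inp.bind fun a => tp a g).getD none) (.load id)

theorem runs_storeOn {tp : Γ₀ → Bool → Option (Option Bool)} {g : Bool} {s : Reg Γ₀} {a : Γ₀}
    (hs : s.inp = some a) (C : Conf Γ₀) :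
    Runs (storeOn tp g) s C.stk s
      { C with tape := Function.update C.tape g ((tp a g).toList ++ C.tape g) }.stk 2 := by
  rw [← Conf.update_tape]
  cases h : tp a g with
  | none =>
    have e : Function.update C.stk (.tape g) (Option.toList none ++ C.tape g) = C.stk :=
      Function.update_eq_self (Stk.tape g) C.stk
    rw [e]
    exact Runs.ite_false (n := 1) (by simp [hs, h]) (Runs.load id s _)
  | some o =>
    have h1 := Runs.push (Γ := Alph Γ₀) (.tape g)
      (fun s : Reg Γ₀ => (s.inp.bind fun a => tp a g).getD none) s C.stk
    refine Runs.ite_true (n := 1) (by simp [hs, h]) ?_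
    simp only [hs, h, Option.bind_some, Option.getD_some] at h1
    exact h1

/-- Write the input on the tapes and count its marked symbols. -/
def store [Inhabited Γ₀] (tp : Γ₀ → Bool → Option (Option Bool)) (mark : Γ₀ → Bool) : Prog Γ₀ :=
  .seq (.loop .inp (fun s o => { s with inp := o }) (fun s => s.inp.isSome)
      (.push .aux fun s => s.inp.getD default))
    (.loop .aux (fun s o => { s with inp := o }) (fun s => s.inp.isSome)
      (.seq (storeOn tp false) (.seq (storeOn tp true)
        (.ite (fun s => (s.inp.map mark).getD false) incrRest (.load id)))))

/-- The input is first reversed onto the auxiliary stack, so that pushing it from there leaves the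
tapes in the original order. Counting marks yields the number of vertices in unary. -/
theorem exec_store [Inhabited Γ₀] (tp : Γ₀ → Bool → Option (Option Bool)) (mark : Γ₀ → Bool)
    (w : List Γ₀) :
    Exec (store tp mark) (Conf.mk w [] (fun _ => []) [] (fun _ => 0) []).stk
      (Conf.mk [] [] (fun g => w.filterMap fun a => tp a g) [] (counters (w.countP mark)) []).stk
      (w.length * 2 + 1 + (w.length * 10 + 1)) := by
  have h1 := exec_transfer (Γ := Alph Γ₀) (k := Stk.inp) (k' := Stk.aux) (by simp)
    (f := fun (s : Reg Γ₀) o => { s with inp := o }) (t := fun s => s.inp.isSome)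
    (g := fun s => s.inp.getD default) id (fun _ => rfl) (fun _ _ => rfl) (fun _ _ => rfl)
    (Conf.mk w [] (fun _ => []) [] (fun _ => 0) []).stk
  rw [Conf.update_inp, Conf.update_aux] at h1
  have e : (List.map id ((Conf.mk w [] (fun _ => []) [] (fun _ => 0) []).stk Stk.inp)).reverse ++
      (Conf.mk w [] (fun _ => []) [] (fun _ => 0) []).stk Stk.aux = w.reverse := by
    simp [Conf.stk]
  rw [e] at h1
  refine h1.seq ?_
  rw [← w.length_reverse]
  -- p is the suffix already written. A body takes at most nine steps: two for each tape and five
  -- for the count.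
  refine exec_loop (Γ := Alph Γ₀) (k := Stk.aux) (N := 9) (J := fun l S => ∃ p, l.reverse ++ p = w ∧ S =
    (Conf.mk [] l (fun g => p.filterMap fun a => tp a g) [] (counters (p.countP mark)) []).stk)
    ?_ (fun _ => rfl) (fun _ _ => rfl) ?_ ?_ (l := w.reverse) ⟨[], by simp, ?_⟩
  · rintro l S ⟨p, -, rfl⟩
    rfl
  · rintro a l S s ⟨p, hp, rfl⟩
    rw [Conf.update_aux]
    have r1 := runs_storeOn (tp := tp) (g := false) (s := { s with inp := some a }) rfl
      (Conf.mk [] l (fun g => p.filterMap fun a => tp a g) [] (counters (p.countP mark)) [])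
    have r2 := runs_storeOn (tp := tp) (g := true) (s := { s with inp := some a }) rfl
      { Conf.mk [] l (fun g => p.filterMap fun a => tp a g) [] (counters (p.countP mark)) [] with
        tape := Function.update (fun g => p.filterMap fun a => tp a g) false
          ((tp a false).toList ++ p.filterMap fun a => tp a false) }
    set C : Conf Γ₀ := Conf.mk [] l (fun g => (a :: p).filterMap fun a => tp a g) []
      (counters (p.countP mark)) [] with hC
    have r3 : ∃ s' n, n ≤ 5 ∧ Runs (.ite (fun s => (s.inp.map mark).getD false) incrRest
        (.load id) : Prog Γ₀) { s with inp := some a } C.stk s'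
        { C with cnt := counters ((a :: p).countP mark) }.stk n := by
      by_cases hm : mark a = true
      · obtain ⟨s', n, hn, hr⟩ := exec_incrRest (C := C) rfl { s with inp := some a }
        refine ⟨s', 1 + n, by omega, Runs.ite_true (by simp [hm]) ?_⟩
        rw [List.countP_cons_of_pos hm]
        exact hr
      · refine ⟨{ s with inp := some a }, 1 + 1, by omega, Runs.ite_false (by simp [hm]) ?_⟩
        rw [List.countP_cons_of_neg hm]
        exact Runs.load id _ _
    obtain ⟨s', n, hn, r3⟩ := r3
    refine ⟨s', _, 2 + (2 + n), ⟨a :: p, by simpa using hp, rfl⟩, by omega, r1.seq (r2.seq ?_)⟩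
    convert r3 using 2
    simp only [hC, Conf.mk.injEq, true_and, and_true]
    funext g
    cases g
    · cases h : tp a false <;> simp [h]
    · cases h : tp a true <;> simp [h]
  · rintro S ⟨p, hp, rfl⟩
    rw [List.reverse_nil, List.nil_append] at hp
    rw [hp]
  · simp only [List.filterMap_nil, List.countP_nil]
    congr 2
    funext c
    cases c <;> rfl

/-- Empty a tape. -/
def clearTape (g : Bool) : Prog Γ₀ :=
  .loop (.tape g) (fun s o => { s with sym := o }) (fun s => s.sym.isSome) (.load id)

theorem exec_clearTape (g : Bool) (C : Conf Γ₀) :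
    Exec (clearTape g) C.stk { C with tape := Function.update C.tape g [] }.stk
      ((C.tape g).length * 2 + 1) := by
  rw [← Conf.update_tape]
  exact exec_clear (fun _ => rfl) (fun _ _ => rfl) C.stk

/-- Empty a counter. -/
def clearCnt (c : Cnt) : Prog Γ₀ :=
  .loop (.cnt c) (fun s o => { s with fst := o }) (fun s => s.fst.isSome) (.load id)

theorem exec_clearCnt (c : Cnt) (C : Conf Γ₀) :
    Exec (clearCnt c) C.stk { C with cnt := Function.update C.cnt c 0 }.stk
      (C.cnt c * 2 + 1) := by
  rw [← Conf.update_cnt]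
  have := exec_clear (Γ := Alph Γ₀) (k := Stk.cnt c) (f := fun (s : Reg Γ₀) o => { s with fst := o })
    (t := fun s => s.fst.isSome) (g := id) (fun _ => rfl) (fun _ _ => rfl) C.stk
  have e : (C.stk (.cnt c)).length = C.cnt c := List.length_replicate
  rw [e] at this
  exact this

/-- Empty the tapes and the counters. -/
def clearAll : Prog Γ₀ :=
  .seq (clearTape false) (.seq (clearTape true) (.seq (clearCnt (.rest 0))
    (.seq (clearCnt (.rest 1)) (.seq (clearCnt (.rest 2)) (clearCnt (.rest 3))))))

theorem exec_clearAll {C : Conf Γ₀} {m : ℕ} (h : C.cnt = counters m) :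
    Exec clearAll C.stk { C with tape := fun _ => [], cnt := fun _ => 0 }.stk
      ((C.tape false).length * 2 + 1 + ((C.tape true).length * 2 + 1 + (m * 2 + 1 + (m * 2 + 1 +
        (m * 2 + 1 + (m * 2 + 1)))))) := by
  have := (exec_clearTape false C).seq ((exec_clearTape true _).seq
    ((exec_clearCnt (.rest 0) _).seq ((exec_clearCnt (.rest 1) _).seq
      ((exec_clearCnt (.rest 2) _).seq (exec_clearCnt (.rest 3) _)))))
  rw [clearAll]
  convert this using 2
  · simp only [Conf.mk.injEq, true_and, and_true]
    rw [h]
    constructor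
    · funext g
      cases g <;> simp
    · funext c
      rcases c with _ | v | v
      · simp [counters]
      · simp [counters]
      · fin_cases v <;> simp
  · simp [h, counters]

theorem _root_.Polynomial.eval_mono_nat (p : Polynomial ℕ) : Monotone fun n => p.eval n := by
  intro m n h
  dsimp only
  rw [Polynomial.eval_eq_sum_range, Polynomial.eval_eq_sum_range]
  gcongr

open scoped Classical in
theorem decidableInPolyTime_of_comp [Fintype Γ₀] [Inhabited Γ₀] {α : Type} {enc : α → List Γ₀}
    {P : α → Prop} {Q : Inst → (Fin 4 → ℕ) → Prop} (hQ : Comp Γ₀ 0 Q) (I : α → Inst)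
    (tp : Γ₀ → Bool → Option (Option Bool)) (mark : Γ₀ → Bool)
    (htp : ∀ a g, ((enc a).filterMap fun b => tp b g) = (I a).word g)
    (hm : ∀ a, (enc a).countP mark = (I a).size) (hP : ∀ a, Q (I a) (fun _ => 0) ↔ P a) :
    DecidableInPolyTime enc P := by
  obtain ⟨c, p, hc⟩ := hQ
  let s₀ : Reg Γ₀ := ⟨none, none, none, none⟩
  -- The final load resets the register, because the prescribed halting configuration carries the
  -- initial one and has only the output stack filled.
  refine decidableInPolyTime_of_runs (Γ := Alph Γ₀)
    (.seq (.seq (store tp mark) (.seq c clearAll)) (.load fun _ => s₀)) s₀ (k₀ := Stk.inp)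
    (k₁ := Stk.acc) (Equiv.refl _) (Equiv.refl _)
    (.X * 2 + 1 + (.X * 10 + 1) + (p + (.X * (.X + 1) * 2 + 1 + (.X * (.X + 1) * 2 + 1 +
      (.X * 2 + 1 + (.X * 2 + 1 + (.X * 2 + 1 + (.X * 2 + 1))))))) + 1)
    (fun a => decide (Q (I a) fun _ => 0)) (fun a => by rw [decide_eq_true_iff, hP]) fun a => ?_
  set J := I a with hJ
  set w := enc a with hw
  -- The marks are among the letters of the input, so a polynomial in the number of vertices is
  -- bounded by the same polynomial in the input length.
  have hsize : J.size ≤ w.length := by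
    rw [← hm a]
    exact List.countP_le_length
  have h1 := exec_store tp mark w
  rw [hm a] at h1
  simp only [hw, htp] at h1
  rw [← hw, ← hJ] at h1
  have h2 := hc J (fun _ => 0) (Conf.mk [] [] (fun g => J.word g) [] (counters J.size) [])
    ⟨fun _ => rfl, rfl, rfl, fun _ => rfl, fun v hv => absurd hv (Nat.not_lt_zero _),
      fun _ _ => rfl, fun _ _ => rfl⟩
  have h3 := exec_clearAll (C := (Conf.mk [] [] (fun g => J.word g) [] (counters J.size)
    [decide (Q J fun _ => 0)] : Conf Γ₀)) rfl
  obtain ⟨s', n, hn, hr⟩ := (h1.seq (h2.seq h3)) s₀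
  refine ⟨n + 1, ?_, ?_⟩
  · rw [J.length_word, J.length_word] at hn
    have hp := p.eval_mono_nat hsize
    dsimp only at hp
    have hq : J.size * (J.size + 1) ≤ w.length * (w.length + 1) := by gcongr
    simp only [Polynomial.eval_add, Polynomial.eval_mul, Polynomial.eval_X, Polynomial.eval_one,
      Polynomial.eval_ofNat]
    linarith
  · have h4 := hr.seq (Runs.load (fun _ => s₀) _ _)
    have ei : Function.update (β := fun k => List (Alph Γ₀ k)) (fun _ => []) Stk.inp (w.map (Equiv.refl Γ₀).symm) =
        (Conf.mk w [] (fun _ => []) [] (fun _ => 0) []).stk := by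
      funext k
      cases k <;> simp [Conf.stk]
    have ea : Function.update (β := fun k => List (Alph Γ₀ k)) (fun _ => []) Stk.acc
        [(Equiv.refl Bool).symm (decide (Q J fun _ => 0))] =
        (Conf.mk [] [] (fun _ => []) [] (fun _ => 0) [decide (Q J fun _ => 0)] :
          Conf Γ₀).stk := by
      funext k
      cases k <;> simp [Conf.stk]
    have := h4
    rw [← ei, ← ea] at this
    exact this

/-! ### The graph criteria as properties with four variables. -/

namespace Inst

/-- Two elements are related in one of the two directions. -/
def Link (I : Inst) (g : Bool) (a b : ℕ) : Prop :=
  I.rel g a b ∨ I.rel g b a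

/-- Two elements are related in both directions. -/
def Same (I : Inst) (g : Bool) (a b : ℕ) : Prop :=
  I.rel g a b ∧ I.rel g b a

/-- The analogue of `LoopedDigraph.Local`. -/
def Loc (I : Inst) (g : Bool) (i : ℕ) : Prop :=
  ∀ a < I.size, ∀ b < I.size, (I.rel g b a → I.rel g a i → I.Link g b i) ∧
    (I.rel g i a → I.rel g a b → I.Link g b i) ∧ (I.rel g a i → I.rel g a b → I.Link g b i) ∧
    (I.rel g a i → I.rel g i b → I.Link g a b)

/-- The analogue of `LoopedDigraph.Reversible`. -/
def Rev (I : Inst) (g : Bool) (i j : ℕ) : Prop :=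
  ¬ I.Same g i j ∧ I.rel g i j ∧ (∀ k < I.size, ¬ I.Same g k i → ¬ I.Same g k j →
    ((I.rel g k i ↔ I.rel g k j) ∧ (I.rel g i k ↔ I.rel g j k))) ∧ I.Loc g i ∧ I.Loc g j

/-- The analogue of `LoopedDigraph.LocallyEquivalent`. -/
def LocEquiv (I : Inst) (i j : ℕ) : Prop :=
  (I.Link false i j ↔ I.Link true i j) ∧
    (¬ I.Same false i j → I.rel false i j → I.rel true j i →
      (∀ k < I.size, (I.Link false i k ↔ I.Link false j k)) ∧ I.Loc false i ∧ I.Loc false j)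

end Inst

namespace Comp

theorem congr {d : ℕ} {P Q : Inst → (Fin 4 → ℕ) → Prop} (hP : Comp Γ₀ d P)
    (h : ∀ I x, P I x ↔ Q I x) : Comp Γ₀ d Q := by
  have : P = Q := funext fun I => funext fun x => propext (h I x)
  rwa [← this]

theorem link {d : ℕ} (g : Bool) (v w : Fin 4) (hv : (v : ℕ) < d) (hw : (w : ℕ) < d) :
    Comp Γ₀ d fun I x => I.Link g (x v) (x w) :=
  (rel g v w hv hw).or (rel g w v hw hv)

theorem same {d : ℕ} (g : Bool) (v w : Fin 4) (hv : (v : ℕ) < d) (hw : (w : ℕ) < d) :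
    Comp Γ₀ d fun I x => I.Same g (x v) (x w) :=
  (rel g v w hv hw).and (rel g w v hw hv)

theorem loc (g : Bool) (v : Fin 4) (hv : (v : ℕ) < 2) : Comp Γ₀ 2 fun I x => I.Loc g (x v) := by
  have hv' : (v : ℕ) < 4 := v.2
  have h2 : ((2 : Fin 4) : ℕ) < 4 := by decide
  have h3 : ((3 : Fin 4) : ℕ) < 4 := by decide
  have hv2 : v ≠ 2 := by rintro rfl; exact absurd hv (by decide)
  have hv3 : v ≠ 3 := by rintro rfl; exact absurd hv (by decide)
  have h := ((rel (Γ₀ := Γ₀) g 3 2 h3 h2).imp ((rel g 2 v h2 hv').imp (link g 3 v h3 hv'))).and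
    (((rel g v 2 hv' h2).imp ((rel g 2 3 h2 h3).imp (link g 3 v h3 hv'))).and
    (((rel g 2 v h2 hv').imp ((rel g 2 3 h2 h3).imp (link g 3 v h3 hv'))).and
    ((rel g 2 v h2 hv').imp ((rel g v 3 hv' h3).imp (link g 2 3 h2 h3)))))
  -- Variables 2 and 3 serve as a and b; the parameter v is 0 or 1.
  refine (all 2 (all 3 h)).congr fun I x => ?_
  simp only [Function.update_self, ne_eq, hv2, hv3, not_false_eq_true, Function.update_of_ne,
    show (2 : Fin 4) ≠ 3 by decide, Inst.Loc]

theorem forall_not_rev (g : Bool) :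
    Comp Γ₀ 0 fun I _ => ∀ i < I.size, ∀ j < I.size, ¬ I.Rev g i j := by
  have h0 : ((0 : Fin 4) : ℕ) < 3 := by decide
  have h1 : ((1 : Fin 4) : ℕ) < 3 := by decide
  have h2 : ((2 : Fin 4) : ℕ) < 3 := by decide
  have h0' : ((0 : Fin 4) : ℕ) < 2 := by decide
  have h1' : ((1 : Fin 4) : ℕ) < 2 := by decide
  have h := (same (Γ₀ := Γ₀) g 2 0 h2 h0).not.imp ((same g 2 1 h2 h1).not.imp
    (((rel g 2 0 h2 h0).iff (rel g 2 1 h2 h1)).and ((rel g 0 2 h0 h2).iff (rel g 1 2 h1 h2))))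
  have h' := (same (Γ₀ := Γ₀) g 0 1 h0' h1').not.and ((rel g 0 1 h0' h1').and
    ((all 2 h).and ((loc g 0 h0').and (loc g 1 h1'))))
  refine (all 0 (all 1 h'.not)).congr fun I x => ?_
  simp only [Function.update_self, ne_eq, not_false_eq_true, Function.update_of_ne,
    show (0 : Fin 4) ≠ 1 by decide, show (0 : Fin 4) ≠ 2 by decide,
    show (1 : Fin 4) ≠ 2 by decide, Inst.Rev]

theorem forall_locEquiv :
    Comp Γ₀ 0 fun I _ => ∀ i < I.size, ∀ j < I.size, I.LocEquiv i j := by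
  have h0 : ((0 : Fin 4) : ℕ) < 3 := by decide
  have h1 : ((1 : Fin 4) : ℕ) < 3 := by decide
  have h2 : ((2 : Fin 4) : ℕ) < 3 := by decide
  have h0' : ((0 : Fin 4) : ℕ) < 2 := by decide
  have h1' : ((1 : Fin 4) : ℕ) < 2 := by decide
  have h := (link (Γ₀ := Γ₀) false 0 2 h0 h2).iff (link false 1 2 h1 h2)
  have h' := ((link (Γ₀ := Γ₀) false 0 1 h0' h1').iff (link true 0 1 h0' h1')).and
    ((same false 0 1 h0' h1').not.imp ((rel false 0 1 h0' h1').imp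
      ((rel true 1 0 h1' h0').imp
        ((all 2 h).and ((loc false 0 h0').and (loc false 1 h1'))))))
  refine (all 0 (all 1 h')).congr fun I x => ?_
  simp only [Function.update_self, ne_eq, not_false_eq_true, Function.update_of_ne,
    show (0 : Fin 4) ≠ 1 by decide, show (0 : Fin 4) ≠ 2 by decide,
    show (1 : Fin 4) ≠ 2 by decide, Inst.LocEquiv]

end Comp

/-- Two graphs as relations on an initial segment of the natural numbers. -/
def Inst.ofGraphs {n : ℕ} (G : Bool → LoopedDigraph (Fin n)) : Inst where
  size := n
  rel g i j := ∃ (hi : i < n) (hj : j < n), (G g).Adj ⟨i, hi⟩ ⟨j, hj⟩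

namespace Inst

variable {n : ℕ} (G : Bool → LoopedDigraph (Fin n))

@[simp]
theorem ofGraphs_size : (ofGraphs G).size = n := rfl

@[simp]
theorem ofGraphs_rel (g : Bool) (i j : Fin n) : (ofGraphs G).rel g i j ↔ (G g).Adj i j :=
  ⟨fun ⟨_, _, h⟩ => h, fun h => ⟨i.2, j.2, h⟩⟩

theorem forall_lt_ofGraphs {p : ℕ → Prop} : (∀ i < (ofGraphs G).size, p i) ↔ ∀ i : Fin n, p i :=
  ⟨fun h i => h i i.2, fun h i hi => h ⟨i, hi⟩⟩

open scoped Classical in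
theorem ofGraphs_word (g : Bool) : (ofGraphs G).word g = encodeGraph (G g) := by
  have h : ∀ i j : Fin n, decide ((ofGraphs G).rel g i j) = decide ((G g).Adj i j) :=
    fun i j => decide_eq_decide.2 (ofGraphs_rel G g i j)
  simp only [word, writtenRows, rows, encodeGraph, adjRows, List.map_ofFn, ofGraphs_size,
    Function.comp_def, h]

@[simp]
theorem ofGraphs_link (g : Bool) (i j : Fin n) :
    (ofGraphs G).Link g i j ↔ (G g).Linked i j := by
  simp [Link, LoopedDigraph.Linked]

/-- Programs query only the edge relations. In a DAG with all self-loops, edges in both directions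
express equality of vertices. -/
theorem ofGraphs_same {g : Bool} (hG : (G g).IsAcyclic) (i j : Fin n) :
    (ofGraphs G).Same g i j ↔ i = j := by
  simp only [Same, ofGraphs_rel]
  refine ⟨fun h => hG.antisymm h.1 h.2, ?_⟩
  rintro rfl
  exact ⟨(G g).loop i, (G g).loop i⟩

@[simp]
theorem ofGraphs_loc (g : Bool) (i : Fin n) : (ofGraphs G).Loc g i ↔ (G g).Local i := by
  simp only [Loc, forall_lt_ofGraphs, ofGraphs_rel, ofGraphs_link, LoopedDigraph.Local]

theorem ofGraphs_rev {g : Bool} (hG : (G g).IsAcyclic) (i j : Fin n) :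
    (ofGraphs G).Rev g i j ↔ (G g).Reversible i j := by
  simp only [Rev, forall_lt_ofGraphs, ofGraphs_rel, ofGraphs_loc, ofGraphs_same G hG]
  exact ⟨fun ⟨h1, h2, h3, h4, h5⟩ => ⟨h1, h2, fun k hi hj => (h3 k hi hj).1,
    fun k hi hj => (h3 k hi hj).2, h4, h5⟩, fun h => ⟨h.ne, h.adj, fun k hi hj =>
    ⟨h.parent k hi hj, h.child k hi hj⟩, h.loc, h.loc'⟩⟩

theorem forall_ofGraphs_locEquiv (hG : (G false).IsAcyclic) :
    (∀ i j : Fin n, (ofGraphs G).LocEquiv i j) ↔ (G false).LocallyEquivalent (G true) := by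
  simp only [LocEquiv, forall_lt_ofGraphs, ofGraphs_rel, ofGraphs_loc, ofGraphs_same G hG,
    ofGraphs_link]
  exact ⟨fun h => ⟨fun a b => (h a b).1, fun i j h1 h2 h3 => ((h i j).2 h1 h2 h3).1,
    fun i j h1 h2 h3 => ((h i j).2 h1 h2 h3).2⟩, fun h i j => ⟨h.linked i j, fun h1 h2 h3 =>
    ⟨h.twin i j h1 h2 h3, h.loc i j h1 h2 h3⟩⟩⟩

end Inst

/-- Each row contributes exactly one end mark. -/
theorem countP_isNone_encodeGraph {n : ℕ} (G : LoopedDigraph (Fin n)) :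
    (encodeGraph G).countP Option.isNone = n := by
  simp [encodeGraph, adjRows, List.countP_flatten, List.map_ofFn, Function.comp_def,
    List.countP_append, List.countP_eq_zero.2]

end StackProgram

/-! ### The two decision procedures. -/

open StackProgram LoopedDigraph

theorem mainTheorem8 (c : ∀ n : ℕ, Fin n → ℝ) (hc : ∀ n i, 0 < c n i) :
    DecidableInPolyTime encodeDAG
      (fun x : (Σ n : ℕ, DAG n) =>
        StructurallyIdentifiableWithin (Matrix.diagonal (c x.1))
          {H : LoopedDigraph (Fin x.1) | H.IsAcyclic} x.2.1) ∧
    DecidableInPolyTime encodeDAGPair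
      (fun x : (Σ n : ℕ, DAG n × DAG n) =>
        ModelEquivalent (Matrix.diagonal (c x.1)) x.2.1.1 x.2.2.1) := by
  constructor
  -- The single input graph is written on both tapes, of which only one is queried.
  · refine decidableInPolyTime_of_comp (Comp.forall_not_rev false)
      (fun x => Inst.ofGraphs fun _ => x.2.1) (fun a _ => some a) Option.isNone ?_ ?_ ?_
    · rintro ⟨n, G⟩ g
      simp [Inst.ofGraphs_word, encodeDAG]
    · rintro ⟨n, G⟩
      exact countP_isNone_encodeGraph G.1
    · rintro ⟨n, G⟩
      simp only [Inst.forall_lt_ofGraphs]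
      rw [structurallyIdentifiableWithin_iff (hc n) G.2]
      simp only [Inst.ofGraphs_rev (fun _ => G.1) (g := false) G.2]
  -- The two copies of the alphabet direct each graph to its own tape; marks are counted on the left
  -- only, so that the count is n and not 2n.
  · refine decidableInPolyTime_of_comp Comp.forall_locEquiv
      (fun x => Inst.ofGraphs fun g => if g then x.2.2.1 else x.2.1.1)
      (fun a g => if g then a.getRight? else a.getLeft?)
      (fun a => (a.getLeft?.map Option.isNone).getD false) ?_ ?_ ?_
    · rintro ⟨n, G, H⟩ (_ | _)
      · simp [Inst.ofGraphs_word, encodeDAGPair, List.filterMap_append, List.filterMap_map,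
          Function.comp_def]
      · simp [Inst.ofGraphs_word, encodeDAGPair, List.filterMap_append, List.filterMap_map,
          Function.comp_def]
    · rintro ⟨n, G, H⟩
      simpa [encodeDAGPair, List.countP_append, List.countP_map, Function.comp_def]
        using countP_isNone_encodeGraph G.1
    · rintro ⟨n, G, H⟩
      simp only [Inst.forall_lt_ofGraphs]
      rw [Inst.forall_ofGraphs_locEquiv _ G.2, modelEquivalent_iff (hc n) G.2 H.2]
      rfl
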